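/- A Jacobi diagram based on two intervals $\downarrow\downarrow$ is a (possibly empty) finite uni-trivalent graph whose trivalent vertices carry cyclic orders and whose univalent vertices are attached to distinct points of two disjoint intervals, both oriented downwards (considered up to isomorphism). Let $\mathcal{A}(\downarrow\downarrow)$ be the $\mathbb{Q}$-vector space spanned by these diagrams modulo the AS, IHX and STU relations; it is an associative unital $\mathbb{Q}$-algebra under stacking, whose unit is the empty diagram. For $m\ge 3$, let $J_m\in\mathcal{A}(\downarrow\downarrow)$ be the class of the following tree drawn in the plane between the two vertical intervals, with counterclockwise cyclic orders at its trivalent vertices: it has $m-1$ trivalent vertices lying on a vertical column, each joined by a horizontal edge to the left interval, and the highest and the lowest of them are, in addition, each joined by a horizontal edge to the right interval (so $J_m$ has $m+1$ univalent vertices, $m-1$ on the left and $2$ on the right interval). Then for every integer $n\ge 2$ the elements $J_3$ and $J_{2n+1}$ of $\mathcal{A}(\downarrow\downarrow)$ do not commute: $$J_3\cdot J_{2n+1}\neq J_{2n+1}\cdot J_3 .$$ -/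

import Mathlib

/-- A Jacobi diagram based on `↓↓`, two disjoint intervals (the strands `0` and `1`), both oriented
downwards. The finite, possibly empty, uni-trivalent graph is given by its half-edges.

* `flip` sends a half-edge to the other half of the same edge.
* `rot` sends a half-edge to the next one, in the given cyclic (counterclockwise) order, at the
  same vertex. The vertices are the orbits of `rot`: a fixed point is a univalent vertex, an orbit
  with three elements is a trivalent vertex with its cyclic order.
* `legs i` lists the univalent vertices attached to strand `i`, in the order in which they are met
  along the orientation (from top to bottom). Every univalent vertex is attached to exactly one
  point of `↓↓`, and distinct univalent vertices to distinct points. -/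
structure JacobiDiagram : Type 1 where
  H : Type
  finite : Finite H
  flip : H → H
  flip_flip : ∀ h, flip (flip h) = h
  flip_ne : ∀ h, flip h ≠ h
  rot : H → H
  rot_rot_rot : ∀ h, rot (rot (rot h)) = h
  legs : Fin 2 → List H
  legs_nodup : ∀ i, (legs i).Nodup
  legs_disjoint : ∀ i j h, h ∈ legs i → h ∈ legs j → i = j
  mem_legs : ∀ h, rot h = h ↔ ∃ i, h ∈ legs i

namespace JacobiDiagram

/-- Isomorphism of Jacobi diagrams. -/
def Iso (D E : JacobiDiagram) : Prop :=
  ∃ e : D.H ≃ E.H, (∀ h, e (D.flip h) = E.flip (e h)) ∧ (∀ h, e (D.rot h) = E.rot (e h)) ∧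
    ∀ i, (D.legs i).map e = E.legs i

theorem Iso.refl (D : JacobiDiagram) : D.Iso D :=
  ⟨Equiv.refl _, fun _ => rfl, fun _ => rfl, fun i => by simp⟩

theorem Iso.symm {D E : JacobiDiagram} (h : D.Iso E) : E.Iso D := by
  obtain ⟨e, h1, h2, h3⟩ := h
  refine ⟨e.symm, fun h => ?_, fun h => ?_, fun i => ?_⟩
  · rw [Equiv.symm_apply_eq, h1, Equiv.apply_symm_apply]
  · rw [Equiv.symm_apply_eq, h2, Equiv.apply_symm_apply]
  · rw [← h3, List.map_map]; simp

theorem Iso.trans {D E F : JacobiDiagram} (h : D.Iso E) (h' : E.Iso F) : D.Iso F := by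
  obtain ⟨e, h1, h2, h3⟩ := h
  obtain ⟨f, k1, k2, k3⟩ := h'
  refine ⟨e.trans f, fun h => ?_, fun h => ?_, fun i => ?_⟩
  · simp [h1, k1]
  · simp [h2, k2]
  · rw [← k3, ← h3, List.map_map]; simp

instance isoSetoid : Setoid JacobiDiagram where
  r := Iso
  iseqv := ⟨Iso.refl, Iso.symm, Iso.trans⟩

/-- The empty Jacobi diagram. -/
abbrev empty : JacobiDiagram where
  H := Empty
  finite := inferInstance
  flip := id
  flip_flip := fun _ => rfl
  flip_ne := fun h => h.elim
  rot := id
  rot_rot_rot := fun _ => rfl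
  legs := fun _ => []
  legs_nodup := fun _ => List.nodup_nil
  legs_disjoint := fun _ _ h => h.elim
  mem_legs := fun h => h.elim

/-- The diagram obtained by stacking `D` on top of `E`. -/
abbrev stack (D E : JacobiDiagram) : JacobiDiagram where
  H := D.H ⊕ E.H
  finite := by
    have := D.finite
    have := E.finite
    infer_instance
  flip := Sum.map D.flip E.flip
  flip_flip := by
    rintro (h | h)
    · simp [D.flip_flip]
    · simp [E.flip_flip]
  flip_ne := by
    rintro (h | h)
    · simp [D.flip_ne]
    · simp [E.flip_ne]
  rot := Sum.map D.rot E.rot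
  rot_rot_rot := by
    rintro (h | h)
    · simp [D.rot_rot_rot]
    · simp [E.rot_rot_rot]
  legs := fun i => (D.legs i).map Sum.inl ++ (E.legs i).map Sum.inr
  legs_nodup := by
    intro i
    refine List.Nodup.append ((D.legs_nodup i).map Sum.inl_injective)
      ((E.legs_nodup i).map Sum.inr_injective) ?_
    intro h h1 h2
    simp only [List.mem_map] at h1 h2
    obtain ⟨a, -, rfl⟩ := h1
    obtain ⟨b, -, hb⟩ := h2
    simp at hb
  legs_disjoint := by
    rintro i j (h | h) h1 h2
    · simp only [List.mem_append, List.mem_map, Sum.inl.injEq, exists_eq_right, reduceCtorEq,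
        and_false, exists_false, or_false] at h1 h2
      exact D.legs_disjoint i j h h1 h2
    · simp only [List.mem_append, List.mem_map, Sum.inr.injEq, exists_eq_right, reduceCtorEq,
        and_false, exists_false, false_or] at h1 h2
      exact E.legs_disjoint i j h h1 h2
  mem_legs := by
    rintro (h | h)
    · simp [D.mem_legs]
    · simp [E.mem_legs]

/-- Cut the edges of `D` and glue them together again after the half-edges have been permuted by
`π`: the place of the half-edge `π h` in the edges is taken by `h`. Vertices, cyclic orders and
attachments to the strands stay the same. -/
abbrev reglue (D : JacobiDiagram) (π : Equiv.Perm D.H) : JacobiDiagram where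
  H := D.H
  finite := D.finite
  flip := fun h => π.symm (D.flip (π h))
  flip_flip := by intro h; simp [D.flip_flip]
  flip_ne := by
    intro h hh
    rw [Equiv.symm_apply_eq] at hh
    exact D.flip_ne _ hh
  rot := D.rot
  rot_rot_rot := D.rot_rot_rot
  legs := D.legs
  legs_nodup := D.legs_nodup
  legs_disjoint := D.legs_disjoint
  mem_legs := D.mem_legs

/-- If `p` and then `q` are consecutive univalent vertices of `D` on strand `i`, the diagram in which
`q` comes before `p`. -/
abbrev transpose (D : JacobiDiagram) (i : Fin 2) (l₁ l₂ : List D.H) (p q : D.H)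
    (h : D.legs i = l₁ ++ p :: q :: l₂) : JacobiDiagram where
  H := D.H
  finite := D.finite
  flip := D.flip
  flip_flip := D.flip_flip
  flip_ne := D.flip_ne
  rot := D.rot
  rot_rot_rot := D.rot_rot_rot
  legs := fun j => if j = i then l₁ ++ q :: p :: l₂ else D.legs j
  legs_nodup := by
    intro j
    have hp : (l₁ ++ q :: p :: l₂).Perm (D.legs i) := by
      rw [h]; exact (List.Perm.swap p q l₂).append_left l₁
    by_cases hj : j = i
    · simp only [hj, if_true]; exact hp.nodup_iff.2 (D.legs_nodup i)
    · simp only [hj, if_false]; exact D.legs_nodup j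
  legs_disjoint := by
    have hp : (l₁ ++ q :: p :: l₂).Perm (D.legs i) := by
      rw [h]; exact (List.Perm.swap p q l₂).append_left l₁
    have key : ∀ j x, x ∈ (if j = i then l₁ ++ q :: p :: l₂ else D.legs j) ↔ x ∈ D.legs j := by
      intro j x
      by_cases hj : j = i
      · simp only [hj, if_true]; exact hp.mem_iff
      · simp only [hj, if_false]
    intro j k x hx hy
    exact D.legs_disjoint j k x ((key j x).1 hx) ((key k x).1 hy)
  mem_legs := by
    have hp : (l₁ ++ q :: p :: l₂).Perm (D.legs i) := by
      rw [h]; exact (List.Perm.swap p q l₂).append_left l₁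
    have key : ∀ j x, x ∈ (if j = i then l₁ ++ q :: p :: l₂ else D.legs j) ↔ x ∈ D.legs j := by
      intro j x
      by_cases hj : j = i
      · simp only [hj, if_true]; exact hp.mem_iff
      · simp only [hj, if_false]
    intro x
    rw [D.mem_legs]
    exact exists_congr fun j => (key j x).symm

open Classical in
/-- If `p` and then `q` are consecutive univalent vertices of `D` on strand `i`, the diagram in which
`p` and `q` are joined at a new trivalent vertex, whose third edge ends on strand `i` at the place
of `p` and `q`. The new edge consists of its end `Sum.inr false` on the strand and of its end
`Sum.inr true` at the new trivalent vertex, where the cyclic order is `(Sum.inr true, q, p)`. -/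
noncomputable abbrev join (D : JacobiDiagram) (i : Fin 2) (l₁ l₂ : List D.H) (p q : D.H)
    (h : D.legs i = l₁ ++ p :: q :: l₂) : JacobiDiagram where
  H := D.H ⊕ Bool
  finite := by
    have := D.finite
    infer_instance
  flip := Sum.map D.flip not
  flip_flip := by
    rintro (h | h)
    · simp [D.flip_flip]
    · simp
  flip_ne := by
    rintro (h | h)
    · simp [D.flip_ne]
    · simp
  rot := fun x => match x with
    | Sum.inl y => if y = q then Sum.inl p else if y = p then Sum.inr true else Sum.inl (D.rot y)
    | Sum.inr true => Sum.inl q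
    | Sum.inr false => Sum.inr false
  rot_rot_rot := by
    have hnd := D.legs_nodup i
    rw [h] at hnd
    have hpq : p ≠ q := by
      rintro rfl
      simp [List.nodup_append] at hnd
    have hp : D.rot p = p := (D.mem_legs p).2 ⟨i, by simp [h]⟩
    have hq : D.rot q = q := (D.mem_legs q).2 ⟨i, by simp [h]⟩
    have hinj : ∀ a b, D.rot a = D.rot b → a = b := fun a b hab => by
      rw [← D.rot_rot_rot a, hab, D.rot_rot_rot]
    have hne : ∀ r y, D.rot r = r → y ≠ r → D.rot y ≠ r := fun r y hr hy hh =>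
      hy (hinj _ _ (hh.trans hr.symm))
    rintro (y | (_ | _))
    · by_cases h1 : y = q
      · subst h1; simp [hpq]
      · by_cases h2 : y = p
        · subst h2; simp [hpq]
        · have a1 := hne q y hq h1
          have a2 := hne p y hp h2
          have b1 := hne q _ hq a1
          have b2 := hne p _ hp a2
          simp [h1, h2, a1, a2, b1, b2, D.rot_rot_rot]
    · simp
    · simp [hpq]
  legs := fun j =>
    if j = i then l₁.map Sum.inl ++ Sum.inr false :: l₂.map Sum.inl else (D.legs j).map Sum.inl
  legs_nodup := by
    intro j
    have hnd := D.legs_nodup i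
    rw [h] at hnd
    by_cases hj : j = i
    · simp only [hj, if_true]
      have h2 : (l₁ ++ l₂).Nodup :=
        hnd.sublist (((List.sublist_cons_self q l₂).trans
          (List.sublist_cons_self p (q :: l₂))).append_left l₁)
      rw [List.nodup_middle, ← List.map_append, List.nodup_cons]
      exact ⟨by simp, h2.map Sum.inl_injective⟩
    · simp only [hj, if_false]; exact (D.legs_nodup j).map Sum.inl_injective
  legs_disjoint := by
    have key : ∀ j x, Sum.inl x ∈ (if j = i then l₁.map Sum.inl ++ Sum.inr false :: l₂.map Sum.inl
        else (D.legs j).map (Sum.inl : D.H → D.H ⊕ Bool)) → x ∈ D.legs j := by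
      intro j x hx
      by_cases hj : j = i
      · subst hj
        simp only [if_true] at hx
        rw [h]
        simp at hx ⊢
        tauto
      · simpa [hj] using hx
    have key2 : ∀ j b, Sum.inr b ∈ (if j = i then l₁.map Sum.inl ++ Sum.inr false :: l₂.map Sum.inl
        else (D.legs j).map (Sum.inl : D.H → D.H ⊕ Bool)) → j = i := by
      intro j b hb
      by_contra hj
      simp [hj] at hb
    rintro j k (x | b) hx hy
    · exact D.legs_disjoint j k x (key j x hx) (key k x hy)
    · exact (key2 j b hx).trans (key2 k b hy).symm
  mem_legs := by
    have hnd := D.legs_nodup i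
    rw [h] at hnd
    have hpq : p ≠ q := by
      rintro rfl
      simp [List.nodup_append] at hnd
    rintro (y | (_ | _))
    · by_cases h1 : y = q
      · subst h1
        simp only [if_true, Sum.inl.injEq, hpq, false_iff, not_exists]
        intro j hj
        by_cases hji : j = i
        · subst hji
          simp [List.nodup_append] at hnd hj
          grind
        · simp [hji] at hj
          exact hji (D.legs_disjoint j i y hj (by simp [h]))
      · by_cases h2 : y = p
        · subst h2
          simp only [h1, if_true, if_false, reduceCtorEq, false_iff, not_exists]
          intro j hj
          by_cases hji : j = i
          · subst hji
            simp [List.nodup_append] at hnd hj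
            grind
          · simp [hji] at hj
            exact hji (D.legs_disjoint j i y hj (by simp [h]))
        · simp only [h1, h2, if_false, Sum.inl.injEq]
          rw [D.mem_legs]
          refine exists_congr fun j => ?_
          by_cases hji : j = i
          · subst hji
            simp [h, h1, h2]
          · simp [hji]
    · simp only [true_iff]
      exact ⟨i, by simp⟩
    · simp only [reduceCtorEq, false_iff, not_exists]
      intro j hj
      by_cases hji : j = i
      · simp [hji] at hj
      · simp [hji] at hj

/-- The rungs and the column of `comb m` below, cut into half-edges: `Sum.inl (k, s)` is the half of
the `k`-th rung at the left strand (`s = false`) or at the column (`s = true`), and `Sum.inr (j, s)`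
is the upper (`s = false`) or the lower (`s = true`) half of the `j`-th edge of the path that starts
on the right strand, runs down the column and ends on the right strand. -/
abbrev CombHalfEdge (m : ℕ) : Type := (Fin m × Bool) ⊕ (Fin (m + 1) × Bool)

/-- At the `k`-th trivalent vertex of `comb m` the counterclockwise order of the half-edges is:
the rung on the left, the edge of the path below, the edge of the path above. -/
def combRot (m : ℕ) : CombHalfEdge m → CombHalfEdge m
  | Sum.inl (k, false) => Sum.inl (k, false)
  | Sum.inl (k, true) => Sum.inr (k.succ, false)
  | Sum.inr (j, false) =>
      Fin.cases (motive := fun _ => CombHalfEdge m) (Sum.inr (0, false))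
        (fun k => Sum.inr (k.castSucc, true)) j
  | Sum.inr (j, true) =>
      Fin.lastCases (motive := fun _ => CombHalfEdge m) (Sum.inr (Fin.last m, true))
        (fun k => Sum.inl (k, true)) j

/-- The tree with `m` trivalent vertices on a vertical column, each of which is joined by a rung to
the left strand, and with both ends of the column attached to the right strand. -/
abbrev comb (m : ℕ) : JacobiDiagram where
  H := CombHalfEdge m
  finite := inferInstance
  flip := Sum.map (fun x => (x.1, !x.2)) (fun x => (x.1, !x.2))
  flip_flip := by rintro (⟨k, s⟩ | ⟨j, s⟩) <;> simp
  flip_ne := by rintro (⟨k, s⟩ | ⟨j, s⟩) <;> simp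
  rot := combRot m
  rot_rot_rot := by
    rintro (⟨k, _ | _⟩ | ⟨j, _ | _⟩)
    · simp [combRot]
    · simp [combRot]
    · induction j using Fin.cases <;> simp [combRot]
    · induction j using Fin.lastCases <;> simp [combRot]
  legs := ![(List.finRange m).map (fun k => Sum.inl (k, false)),
    [Sum.inr (0, false), Sum.inr (Fin.last m, true)]]
  legs_nodup := by
    intro i
    fin_cases i
    · refine (List.nodup_finRange m).map ?_
      intro a b hab
      simpa using hab
    · simp
  legs_disjoint := by
    intro i j h hi hj
    fin_cases i <;> fin_cases j <;> simp at hi hj ⊢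
    · grind
    · grind
  mem_legs := by
    rintro (⟨k, _ | _⟩ | ⟨j, _ | _⟩)
    · simp [combRot]
    · simp [combRot]
    · induction j using Fin.cases <;> simp [combRot, Fin.ext_iff]
    · induction j using Fin.lastCases <;> simp [combRot, Fin.ext_iff]
      omega

end JacobiDiagram

/-- Jacobi diagrams based on `↓↓` up to isomorphism. -/
def JacobiClass : Type 1 := Quotient JacobiDiagram.isoSetoid

/-- The isomorphism class of a Jacobi diagram. -/
def JacobiDiagram.toClass (D : JacobiDiagram) : JacobiClass := Quotient.mk _ D

namespace JacobiDiagram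

theorem Iso.stack {D D' E E' : JacobiDiagram} (h : D.Iso D') (h' : E.Iso E') :
    (D.stack E).Iso (D'.stack E') := by
  obtain ⟨e, h1, h2, h3⟩ := h
  obtain ⟨f, k1, k2, k3⟩ := h'
  refine ⟨Equiv.sumCongr e f, ?_, ?_, fun i => ?_⟩
  · rintro (x | x)
    · simp [JacobiDiagram.stack, h1]
    · simp [JacobiDiagram.stack, k1]
  · rintro (x | x)
    · simp [JacobiDiagram.stack, h2]
    · simp [JacobiDiagram.stack, k2]
  · simp only [JacobiDiagram.stack, ← h3, ← k3, List.map_append, List.map_map]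
    rfl

theorem stack_assoc_iso (D E F : JacobiDiagram) :
    ((D.stack E).stack F).Iso (D.stack (E.stack F)) := by
  refine ⟨Equiv.sumAssoc _ _ _, ?_, ?_, fun i => ?_⟩
  · rintro ((x | x) | x) <;> rfl
  · rintro ((x | x) | x) <;> rfl
  · simp only [stack, List.map_append, List.map_map, List.append_assoc]
    rfl

theorem empty_stack_iso (D : JacobiDiagram) : (empty.stack D).Iso D := by
  refine ⟨Equiv.emptySum _ _, ?_, ?_, fun i => ?_⟩
  · rintro (x | x)
    · exact x.elim
    · rfl
  · rintro (x | x)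
    · exact x.elim
    · rfl
  · simp only [stack, empty, List.map_nil, List.nil_append, List.map_map]
    exact List.map_id _

theorem stack_empty_iso (D : JacobiDiagram) : (D.stack empty).Iso D := by
  refine ⟨Equiv.sumEmpty _ _, ?_, ?_, fun i => ?_⟩
  · rintro (x | x)
    · rfl
    · exact x.elim
  · rintro (x | x)
    · rfl
    · exact x.elim
  · simp only [stack, empty, List.map_nil, List.append_nil, List.map_map]
    exact List.map_id _

end JacobiDiagram

namespace JacobiClass

theorem exists_toClass (c : JacobiClass) : ∃ D : JacobiDiagram, D.toClass = c :=
  Quotient.exists_rep c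

/-- Isomorphism classes of diagrams form a monoid under stacking. -/
instance : Monoid JacobiClass where
  mul := Quotient.map₂ JacobiDiagram.stack fun _ _ h _ _ h' => JacobiDiagram.Iso.stack h h'
  one := JacobiDiagram.empty.toClass
  mul_assoc := by
    rintro ⟨D⟩ ⟨E⟩ ⟨F⟩
    exact Quotient.sound (JacobiDiagram.stack_assoc_iso D E F)
  one_mul := by
    rintro ⟨D⟩
    exact Quotient.sound (JacobiDiagram.empty_stack_iso D)
  mul_one := by
    rintro ⟨D⟩
    exact Quotient.sound (JacobiDiagram.stack_empty_iso D)

end JacobiClass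

namespace JacobiDiagram

/-- The basis element of `ℚ[JacobiClass]`, the `ℚ`-vector space on all Jacobi diagrams based on `↓↓`,
given by a diagram. -/
noncomputable def basis (D : JacobiDiagram) : MonoidAlgebra ℚ JacobiClass :=
  MonoidAlgebra.single D.toClass 1

theorem basis_eq {D E : JacobiDiagram} (h : D.Iso E) : D.basis = E.basis := by
  unfold basis
  congr 1
  exact Quotient.sound h

theorem basis_mul (D E : JacobiDiagram) : D.basis * E.basis = (D.stack E).basis := by
  unfold basis
  rw [MonoidAlgebra.single_mul_single, one_mul]
  rfl

open Classical in
/-- The permutation of `H` that exchanges `a` and `b`. -/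
noncomputable def exchange {H : Type} (a b : H) : Equiv.Perm H := Equiv.swap a b

/-- The left hand sides of the AS, IHX and STU relations.

* AS: at a trivalent vertex `(x, a, b)` the ends of the edges at `a` and `b` are exchanged.
* IHX: an edge joins two distinct trivalent vertices `(x, a, b)` and `(y, c, d)`, at `x` and `y`. The
  three terms arise by permuting the three ends of edges at `a`, `b`, `c` cyclically.
* STU: the terms differ near two consecutive univalent vertices `p`, `q` on a strand. -/
inductive IsRelator : MonoidAlgebra ℚ JacobiClass → Prop
  | as (D : JacobiDiagram) (x : D.H) (hx : D.rot x ≠ x) :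
      IsRelator (D.basis + (D.reglue (exchange (D.rot x) (D.rot (D.rot x)))).basis)
  | ihx (D : JacobiDiagram) (x : D.H) (hx : D.rot x ≠ x) (hy : D.rot (D.flip x) ≠ D.flip x)
      (h₁ : D.flip x ≠ D.rot x) (h₂ : D.flip x ≠ D.rot (D.rot x)) (π : Equiv.Perm D.H)
      (hπ : π = exchange (D.rot x) (D.rot (D.rot x)) *
        exchange (D.rot (D.rot x)) (D.rot (D.flip x))) :
      IsRelator (D.basis + (D.reglue π).basis + (D.reglue (π * π)).basis)
  | stu (D : JacobiDiagram) (i : Fin 2) (l₁ l₂ : List D.H) (p q : D.H)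
      (h : D.legs i = l₁ ++ p :: q :: l₂) :
      IsRelator ((D.join i l₁ l₂ p q h).basis - D.basis + (D.transpose i l₁ l₂ p q h).basis)

/-- The linear span of the AS, IHX and STU relations. -/
noncomputable def relations : Submodule ℚ (MonoidAlgebra ℚ JacobiClass) :=
  Submodule.span ℚ {r | IsRelator r}

theorem stack_reglue (E D : JacobiDiagram) (π : Equiv.Perm D.H) :
    (E.stack (D.reglue π)).Iso ((E.stack D).reglue (Equiv.sumCongr (Equiv.refl E.H) π)) := by
  refine ⟨Equiv.refl _, ?_, fun h => rfl, fun i => List.map_id _⟩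
  rintro (x | x) <;> rfl

theorem reglue_stack (D E : JacobiDiagram) (π : Equiv.Perm D.H) :
    ((D.reglue π).stack E).Iso ((D.stack E).reglue (Equiv.sumCongr π (Equiv.refl E.H))) := by
  refine ⟨Equiv.refl _, ?_, fun h => rfl, fun i => List.map_id _⟩
  rintro (x | x) <;> rfl

theorem exchange_map {α β : Type} (f : α → β) (hf : Function.Injective f) (a b x : α) :
    f (exchange a b x) = exchange (f a) (f b) (f x) := by
  classical
  unfold exchange
  rw [Equiv.swap_apply_def, Equiv.swap_apply_def]
  by_cases h1 : x = a
  · simp [h1]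
  · by_cases h2 : x = b
    · subst h2; simp [h1, hf.ne h1]
    · simp [h1, h2, hf.ne h1, hf.ne h2]

theorem exchange_of_ne {α : Type} {a b x : α} (ha : x ≠ a) (hb : x ≠ b) :
    exchange a b x = x := by
  classical
  exact Equiv.swap_apply_of_ne_of_ne ha hb

theorem sumCongr_refl_exchange (α : Type) {β : Type} (a b : β) :
    Equiv.sumCongr (Equiv.refl α) (exchange a b) =
      exchange (Sum.inr a : α ⊕ β) (Sum.inr b) := by
  refine Equiv.ext ?_
  rintro (x | x)
  · exact (exchange_of_ne Sum.inl_ne_inr Sum.inl_ne_inr).symm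
  · exact exchange_map Sum.inr Sum.inr_injective a b x

theorem sumCongr_exchange_refl {α : Type} (β : Type) (a b : α) :
    Equiv.sumCongr (exchange a b) (Equiv.refl β) =
      exchange (Sum.inl a : α ⊕ β) (Sum.inl b) := by
  refine Equiv.ext ?_
  rintro (x | x)
  · exact exchange_map Sum.inl Sum.inl_injective a b x
  · exact (exchange_of_ne Sum.inr_ne_inl Sum.inr_ne_inl).symm

theorem sumCongr_refl_mul (α : Type) {β : Type} (π ρ : Equiv.Perm β) :
    Equiv.sumCongr (Equiv.refl α) (π * ρ) =
      (Equiv.sumCongr (Equiv.refl α) π * Equiv.sumCongr (Equiv.refl α) ρ : Equiv.Perm (α ⊕ β)) := by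
  ext (x | x) <;> rfl

theorem sumCongr_mul_refl {α : Type} (β : Type) (π ρ : Equiv.Perm α) :
    Equiv.sumCongr (π * ρ) (Equiv.refl β) =
      (Equiv.sumCongr π (Equiv.refl β) * Equiv.sumCongr ρ (Equiv.refl β) : Equiv.Perm (α ⊕ β)) := by
  ext (x | x) <;> rfl

theorem stack_legs_right (E D : JacobiDiagram) {i : Fin 2} {l₁ l₂ : List D.H} {p q : D.H}
    (h : D.legs i = l₁ ++ p :: q :: l₂) :
    (E.stack D).legs i = ((E.legs i).map Sum.inl ++ l₁.map Sum.inr) ++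
      Sum.inr p :: Sum.inr q :: l₂.map Sum.inr := by
  simp [stack, h]

theorem stack_legs_left (D E : JacobiDiagram) {i : Fin 2} {l₁ l₂ : List D.H} {p q : D.H}
    (h : D.legs i = l₁ ++ p :: q :: l₂) :
    (D.stack E).legs i = l₁.map Sum.inl ++
      Sum.inl p :: Sum.inl q :: (l₂.map Sum.inl ++ (E.legs i).map Sum.inr) := by
  simp [stack, h]

theorem stack_transpose (E D : JacobiDiagram) {i : Fin 2} {l₁ l₂ : List D.H} {p q : D.H}
    (h : D.legs i = l₁ ++ p :: q :: l₂) :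
    (E.stack (D.transpose i l₁ l₂ p q h)).Iso
      ((E.stack D).transpose i _ _ _ _ (stack_legs_right E D h)) := by
  refine ⟨Equiv.refl _, fun _ => rfl, fun _ => rfl, fun j => (List.map_id _).trans ?_⟩
  by_cases hj : j = i
  · subst hj; simp [stack, transpose]
  · simp [stack, transpose, hj]

theorem transpose_stack (D E : JacobiDiagram) {i : Fin 2} {l₁ l₂ : List D.H} {p q : D.H}
    (h : D.legs i = l₁ ++ p :: q :: l₂) :
    ((D.transpose i l₁ l₂ p q h).stack E).Iso
      ((D.stack E).transpose i _ _ _ _ (stack_legs_left D E h)) := by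
  refine ⟨Equiv.refl _, fun _ => rfl, fun _ => rfl, fun j => (List.map_id _).trans ?_⟩
  by_cases hj : j = i
  · subst hj; simp [stack, transpose]
  · simp [stack, transpose, hj]

theorem stack_join (E D : JacobiDiagram) {i : Fin 2} {l₁ l₂ : List D.H} {p q : D.H}
    (h : D.legs i = l₁ ++ p :: q :: l₂) :
    (E.stack (D.join i l₁ l₂ p q h)).Iso
      ((E.stack D).join i _ _ _ _ (stack_legs_right E D h)) := by
  refine ⟨(Equiv.sumAssoc E.H D.H Bool).symm, ?_, ?_, fun j => ?_⟩
  · rintro (x | (x | x)) <;> rfl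
  · rintro (x | (x | (_ | _)))
    · simp [stack, join]
    · by_cases h1 : x = q
      · simp [stack, join, h1]
      · by_cases h2 : x = p
        · subst h2; simp [stack, join, h1]
        · simp [stack, join, h1, h2]
    · rfl
    · rfl
  · by_cases hj : j = i
    · subst hj; simp [stack, join, Function.comp_def]
    · simp [stack, join, hj, Function.comp_def]

theorem join_stack (D E : JacobiDiagram) {i : Fin 2} {l₁ l₂ : List D.H} {p q : D.H}
    (h : D.legs i = l₁ ++ p :: q :: l₂) :
    ((D.join i l₁ l₂ p q h).stack E).Iso
      ((D.stack E).join i _ _ _ _ (stack_legs_left D E h)) := by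
  refine ⟨⟨fun x => match x with
      | Sum.inl (Sum.inl y) => Sum.inl (Sum.inl y)
      | Sum.inl (Sum.inr b) => Sum.inr b
      | Sum.inr y => Sum.inl (Sum.inr y),
    fun x => match x with
      | Sum.inl (Sum.inl y) => Sum.inl (Sum.inl y)
      | Sum.inl (Sum.inr y) => Sum.inr y
      | Sum.inr b => Sum.inl (Sum.inr b), ?_, ?_⟩, ?_, ?_, fun j => ?_⟩
  · rintro ((x | x) | x) <;> rfl
  · rintro ((x | x) | x) <;> rfl
  · rintro ((x | x) | x) <;> rfl
  · rintro ((x | (_ | _)) | x)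
    · by_cases h1 : x = q
      · simp [stack, join, h1]
      · by_cases h2 : x = p
        · subst h2; simp [stack, join, h1]
        · simp [stack, join, h1, h2]
    · rfl
    · rfl
    · simp [stack, join]
  · by_cases hj : j = i
    · subst hj; simp [stack, join, Function.comp_def]
    · simp [stack, join, hj, Function.comp_def]

theorem IsRelator.basis_mul {r : MonoidAlgebra ℚ JacobiClass} (hr : IsRelator r)
    (E : JacobiDiagram) : IsRelator (E.basis * r) := by
  cases hr with
  | as D x hx =>
    rw [mul_add, JacobiDiagram.basis_mul, JacobiDiagram.basis_mul, basis_eq (stack_reglue E D _),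
      sumCongr_refl_exchange]
    exact IsRelator.as (E.stack D) (Sum.inr x) (by simpa [stack] using hx)
  | ihx D x hx hy h₁ h₂ π hπ =>
    rw [mul_add, mul_add, JacobiDiagram.basis_mul, JacobiDiagram.basis_mul,
      JacobiDiagram.basis_mul, basis_eq (stack_reglue E D _), basis_eq (stack_reglue E D _),
      sumCongr_refl_mul]
    refine IsRelator.ihx (E.stack D) (Sum.inr x) (by simpa [stack] using hx)
      (by simpa [stack] using hy) (by simpa [stack] using h₁) (by simpa [stack] using h₂) _ ?_
    rw [hπ, sumCongr_refl_mul, sumCongr_refl_exchange, sumCongr_refl_exchange]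
    rfl
  | stu D i l₁ l₂ p q h =>
    rw [mul_add, mul_sub, JacobiDiagram.basis_mul, JacobiDiagram.basis_mul,
      JacobiDiagram.basis_mul, basis_eq (stack_join E D h), basis_eq (stack_transpose E D h)]
    exact IsRelator.stu (E.stack D) i _ _ _ _ (stack_legs_right E D h)

theorem IsRelator.mul_basis {r : MonoidAlgebra ℚ JacobiClass} (hr : IsRelator r)
    (E : JacobiDiagram) : IsRelator (r * E.basis) := by
  cases hr with
  | as D x hx =>
    rw [add_mul, JacobiDiagram.basis_mul, JacobiDiagram.basis_mul, basis_eq (reglue_stack D E _),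
      sumCongr_exchange_refl]
    exact IsRelator.as (D.stack E) (Sum.inl x) (by simpa [stack] using hx)
  | ihx D x hx hy h₁ h₂ π hπ =>
    rw [add_mul, add_mul, JacobiDiagram.basis_mul, JacobiDiagram.basis_mul,
      JacobiDiagram.basis_mul, basis_eq (reglue_stack D E _), basis_eq (reglue_stack D E _),
      sumCongr_mul_refl]
    refine IsRelator.ihx (D.stack E) (Sum.inl x) (by simpa [stack] using hx)
      (by simpa [stack] using hy) (by simpa [stack] using h₁) (by simpa [stack] using h₂) _ ?_
    rw [hπ, sumCongr_mul_refl, sumCongr_exchange_refl, sumCongr_exchange_refl]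
    rfl
  | stu D i l₁ l₂ p q h =>
    rw [add_mul, sub_mul, JacobiDiagram.basis_mul, JacobiDiagram.basis_mul,
      JacobiDiagram.basis_mul, basis_eq (join_stack D E h), basis_eq (transpose_stack D E h)]
    exact IsRelator.stu (D.stack E) i _ _ _ _ (stack_legs_left D E h)

theorem single_eq_smul_basis (D : JacobiDiagram) (c : ℚ) :
    (MonoidAlgebra.single D.toClass c : MonoidAlgebra ℚ JacobiClass) =
      c • D.basis := by
  simp [basis]

theorem mul_mem_relations_left (x : MonoidAlgebra ℚ JacobiClass)
    {r : MonoidAlgebra ℚ JacobiClass} (hr : r ∈ relations) : x * r ∈ relations := by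
  induction x using MonoidAlgebra.induction_linear with
  | zero => simp
  | add f g hf hg => rw [add_mul]; exact relations.add_mem hf hg
  | single D c =>
    obtain ⟨D, rfl⟩ := D.exists_toClass
    · rw [single_eq_smul_basis, smul_mul_assoc]
      refine relations.smul_mem c ?_
      unfold relations at hr
      induction hr using Submodule.span_induction with
      | mem r hr => exact Submodule.subset_span (hr.basis_mul D)
      | zero => simp
      | add f g _ _ hf hg => rw [mul_add]; exact relations.add_mem hf hg
      | smul a f _ hf => rw [mul_smul_comm]; exact relations.smul_mem a hf

theorem mul_mem_relations_right (x : MonoidAlgebra ℚ JacobiClass)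
    {r : MonoidAlgebra ℚ JacobiClass} (hr : r ∈ relations) : r * x ∈ relations := by
  induction x using MonoidAlgebra.induction_linear with
  | zero => simp
  | add f g hf hg => rw [mul_add]; exact relations.add_mem hf hg
  | single D c =>
    obtain ⟨D, rfl⟩ := D.exists_toClass
    · rw [single_eq_smul_basis, mul_smul_comm]
      refine relations.smul_mem c ?_
      unfold relations at hr
      induction hr using Submodule.span_induction with
      | mem r hr => exact Submodule.subset_span (hr.mul_basis D)
      | zero => simp
      | add f g _ _ hf hg => rw [add_mul]; exact relations.add_mem hf hg
      | smul a f _ hf => rw [smul_mul_assoc]; exact relations.smul_mem a hf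

/-- Congruence modulo the linear span of the AS, IHX and STU relations; it is compatible with
stacking. -/
noncomputable def relationsCon : RingCon (MonoidAlgebra ℚ JacobiClass) where
  r x y := x - y ∈ relations
  iseqv :=
    { refl := fun x => by rw [sub_self]; exact relations.zero_mem
      symm := fun {x y} h => by rw [← neg_sub]; exact relations.neg_mem h
      trans := fun {x y z} h h' => by
        rw [← sub_add_sub_cancel x y z]; exact relations.add_mem h h' }
  mul' := fun {w x y z} h h' => by
    have : w * y - x * z = (w - x) * y + x * (y - z) := by rw [sub_mul, mul_sub]; abel
    rw [this]
    exact relations.add_mem (mul_mem_relations_right y h) (mul_mem_relations_left x h')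
  add' := fun {w x y z} h h' => by
    rw [add_sub_add_comm]
    exact relations.add_mem h h'

end JacobiDiagram

/-- The algebra `𝒜(↓↓)`: the quotient of the `ℚ`-vector space on all Jacobi diagrams based on `↓↓` by
the span of the AS, IHX and STU relations. The product is induced by stacking, and the unit is the
class of the empty diagram. -/
abbrev JacobiAlgebra : Type 1 := JacobiDiagram.relationsCon.Quotient

/-- The class of a Jacobi diagram in `𝒜(↓↓)`. -/
noncomputable def JacobiDiagram.toAlgebra (D : JacobiDiagram) : JacobiAlgebra :=
  (D.basis : JacobiDiagram.relationsCon.Quotient)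

/-- `J_n` (for `n ≥ 3`), the comb with `n - 1` legs on the left strand and `2` legs on the right. -/
noncomputable def jacobiJ (n : ℕ) : JacobiAlgebra :=
  (JacobiDiagram.comb (n - 1)).toAlgebra

/-! Two elements of the algebra are told apart by a Lie algebra weight. Half-edges are labelled by a
basis of a metrized Lie algebra, trivalent vertices are evaluated by the invariant trilinear form,
and the word of labels along each strand is evaluated by a linear form on the enveloping algebra. AS
holds by antisymmetry, IHX by the Jacobi identity and STU by `p q - q p = [p, q]` (`weight_as`,
`weight_ihx`, `weight_stu`), so the weight depends only on the class in the algebra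
(`weight_eq_of_toAlgebra_eq`).

The Lie algebra is `𝔤𝔩₃` with the trace form. Let `N = 2 + 2n` be the number of left legs of either
product. On the left strand the linear form is the `N`-th convolution power of `w ↦ tr (c w)`,
corrected to vanish at the empty word, for a diagonal matrix `c`; on words of length `N` it is `N!`
times the product of the values at the letters (`wordPow_eq`). So every left leg is contracted with
`c`, and the column of a comb with `m` rungs becomes the `m`-th power of an operator `± ad c`,
diagonal in the matrix units. The comb thus puts `∑ (c_j - c_i)^m E_ij E_ji` on the right strand
(`LieForm.sum_comb`).

On the right strand the linear form is a matrix coefficient of the representation on `V ⊗ V ⊗ V`,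
where `V` is the standard representation, between two tensors that permute `e₀ ⊗ e₁ ⊗ e₂`. On the
span of the permuted tensors `E_ij E_ji` with `i ≠ j` acts as `1` plus the transposition that
exchanges the symbols `e_i` and `e_j`. The commutator of the two combs is therefore a combination of
the two 3-cycles. With `x` running through the three squares `(c_i - c_j)²`, its coefficients are,
up to sign, four times the generalized Vandermonde determinant of `1`, `x`, `x^n`. For `x = 1, 4, 9`
this is `3 · 9^n - 8 · 4^n + 5`, which vanishes at `n = 1` and is positive for `n ≥ 2`. -/

/-! ### Weights of diagrams from a metrized Lie algebra. -/

/-- The structure constants of a metrized Lie algebra in a finite basis `B`: `dual b` is the basis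
vector dual to `b` under the invariant form, and `form a b c` is the invariant trilinear form, which
takes the values `-1`, `0` and `1` only. -/
structure LieForm (B : Type) [Fintype B] where
  dual : B → B
  dual_dual : ∀ b, dual (dual b) = b
  form : B → B → B → ℤ
  form_rot : ∀ a b c, form b c a = form a b c
  form_swap : ∀ a b c, form a c b = -form a b c
  form_cube : ∀ a b c, form a b c * form a b c * form a b c = form a b c
  jacobi : ∀ a b c d, ∑ e, (form e a b * form (dual e) c d + form e b c * form (dual e) a d +
    form e c a * form (dual e) b d) = 0

namespace LieForm

variable {B : Type} [Fintype B] (L : LieForm B) {H : Type}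

/-- A function on words in the basis that comes from a linear form on the enveloping algebra. -/
def IsEnveloping (Φ : List B → ℤ) : Prop :=
  ∀ l₁ l₂ p q, Φ (l₁ ++ p :: q :: l₂) - Φ (l₁ ++ q :: p :: l₂) =
    ∑ e, L.form (L.dual e) q p * Φ (l₁ ++ e :: l₂)

open Classical in
/-- The contribution of the half-edge `h` to the product over the vertices; a trivalent vertex is
counted three times, which does not matter as the values of the form are `-1`, `0` and `1`. -/
noncomputable def localForm (rot : H → H) (ℓ : H → B) (h : H) : ℤ :=
  if rot h = h then 1 else L.form (ℓ h) (ℓ (rot h)) (ℓ (rot (rot h)))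

/-- The product over the trivalent vertices of the values of the form. -/
noncomputable def vertexProd [Fintype H] (rot : H → H) (ℓ : H → B) : ℤ :=
  ∏ h, L.localForm rot ℓ h

/-- The two ends of every edge have dual labels. -/
def Admissible (flip : H → H) (ℓ : H → B) : Prop :=
  ∀ h, ℓ (flip h) = L.dual (ℓ h)

/-- The product of the contributions of the vertices and of the strands to the weight. -/
noncomputable def term [Fintype H] (Φ : Fin 2 → List B → ℤ) (rot : H → H) (legs : Fin 2 → List H)
    (ℓ : H → B) :
    ℤ :=
  L.vertexProd rot ℓ * ∏ i, Φ i ((legs i).map ℓ)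

open Classical in
/-- The weight of a diagram: the sum over all labelings of its half-edges. -/
noncomputable def weight [Fintype H] (Φ : Fin 2 → List B → ℤ) (flip rot : H → H)
    (legs : Fin 2 → List H) : ℤ :=
  ∑ ℓ : H → B, if L.Admissible flip ℓ then L.term Φ rot legs ℓ else 0

open Classical in
theorem weight_eq [Fintype H] [DecidableEq H] (Φ : Fin 2 → List B → ℤ) (flip rot : H → H)
    (legs : Fin 2 → List H) : L.weight Φ flip rot legs =
      ∑ ℓ : H → B, if L.Admissible flip ℓ then L.term Φ rot legs ℓ else 0 := by
  unfold weight
  congr!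

theorem weight_congr [Fintype H] {H' : Type} [Fintype H'] (Φ : Fin 2 → List B → ℤ)
    {flip rot : H → H} {legs : Fin 2 → List H} {flip' rot' : H' → H'} {legs' : Fin 2 → List H'} (e : H ≃ H')
    (h₁ : ∀ h, e (flip h) = flip' (e h)) (h₂ : ∀ h, e (rot h) = rot' (e h))
    (h₃ : ∀ i, (legs i).map e = legs' i) :
    L.weight Φ flip rot legs = L.weight Φ flip' rot' legs' := by
  classical
  unfold weight
  rw [← Equiv.sum_comp (Equiv.arrowCongr e.symm (Equiv.refl B))]
  refine Finset.sum_congr rfl fun ℓ _ => ?_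
  have h0 : (Equiv.arrowCongr e.symm (Equiv.refl B)) ℓ = ℓ ∘ e := by
    ext; simp [Equiv.arrowCongr]
  rw [h0]
  have hA : L.Admissible flip (ℓ ∘ e) ↔ L.Admissible flip' ℓ := by
    unfold Admissible
    rw [← e.forall_congr_right (q := fun h => ℓ (flip' h) = L.dual (ℓ h))]
    simp [h₁]
  have hV : L.vertexProd rot (ℓ ∘ e) = L.vertexProd rot' ℓ := by
    unfold vertexProd
    rw [← Equiv.prod_comp e]
    refine Finset.prod_congr rfl fun h _ => ?_
    simp [localForm, ← h₂]
  simp only [hA, term, hV, ← List.map_map, h₃]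

theorem localForm_congr {rot : H → H} {ℓ ℓ' : H → B} {h : H} (h₁ : ℓ h = ℓ' h)
    (h₂ : ℓ (rot h) = ℓ' (rot h)) (h₃ : ℓ (rot (rot h)) = ℓ' (rot (rot h))) :
    L.localForm rot ℓ h = L.localForm rot ℓ' h := by
  simp [localForm, h₁, h₂, h₃]

/-- The half-edges at the vertex of `x`. -/
def orbit [DecidableEq H] (rot : H → H) (x : H) : Finset H := {x, rot x, rot (rot x)}

theorem rot_ne {rot : H → H} (hrot : ∀ h, rot (rot (rot h)) = h) {x : H} (hx : rot x ≠ x) :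
    rot (rot x) ≠ rot x ∧ rot (rot x) ≠ x := by
  refine ⟨fun h => hx ?_, fun h => hx ?_⟩
  · have := hrot x
    rw [h, h] at this
    exact this
  · have := hrot x
    rw [h] at this
    exact this

/-- The three half-edges of a vertex contribute the same number by cyclic invariance, and
`form_cube` reduces its cube to the number itself. -/
theorem prod_orbit [DecidableEq H] {rot : H → H} (hrot : ∀ h, rot (rot (rot h)) = h)
    {x : H} (hx : rot x ≠ x) (ℓ : H → B) :
    ∏ h ∈ orbit rot x, L.localForm rot ℓ h = L.form (ℓ x) (ℓ (rot x)) (ℓ (rot (rot x))) := by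
  obtain ⟨h1, h2⟩ := rot_ne hrot hx
  unfold orbit
  rw [Finset.prod_insert (by simp [hx.symm, h2.symm]), Finset.prod_insert (by simp [h1.symm]),
    Finset.prod_singleton]
  simp only [localForm, hrot, hx, h1, if_false, h2.symm, L.form_rot, ← mul_assoc]
  rw [L.form_cube]

theorem mem_orbit_rot [DecidableEq H] {rot : H → H} (hrot : ∀ h, rot (rot (rot h)) = h)
    {x h : H} : rot h ∈ orbit rot x ↔ h ∈ orbit rot x := by
  have inj : ∀ a b, rot a = rot b ↔ a = b := fun a b =>
    ⟨fun hab => by rw [← hrot a, hab, hrot], fun hab => by rw [hab]⟩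
  simp only [orbit, Finset.mem_insert, Finset.mem_singleton, inj]
  have : rot h = x ↔ h = rot (rot x) := by
    rw [← inj, ← inj, hrot, ← inj, hrot]
  rw [this]
  tauto

end LieForm

/-! ### The AS, IHX and STU relations for weights. -/

namespace LieForm

variable {B : Type} [Fintype B] (L : LieForm B) {H : Type}

-- The substitution `ℓ ↦ ℓ ∘ π` moves the permutation from the edges to the vertices. The diagrams
-- in an AS or IHX relation then become sums over the same labelings and can be compared term by
-- term.
open Classical in
theorem weight_reglue [Fintype H] (Φ : Fin 2 → List B → ℤ) (flip rot : H → H)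
    (legs : Fin 2 → List H) (π : Equiv.Perm H) (hlegs : ∀ i, ∀ h ∈ legs i, π h = h) :
    L.weight Φ (fun h => π.symm (flip (π h))) rot legs =
      ∑ ℓ : H → B, if L.Admissible flip ℓ then
        L.vertexProd rot (ℓ ∘ π) * ∏ i, Φ i ((legs i).map ℓ) else 0 := by
  classical
  unfold weight
  rw [← Equiv.sum_comp (Equiv.arrowCongr π.symm (Equiv.refl B))]
  refine Finset.sum_congr rfl fun ℓ _ => ?_
  have h0 : (Equiv.arrowCongr π.symm (Equiv.refl B)) ℓ = ℓ ∘ π := by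
    ext; simp [Equiv.arrowCongr]
  rw [h0]
  have hA : L.Admissible (fun h => π.symm (flip (π h))) (ℓ ∘ π) ↔ L.Admissible flip ℓ := by
    unfold Admissible
    rw [← π.forall_congr_right (q := fun h => ℓ (flip h) = L.dual (ℓ h))]
    simp
  have hl : ∀ i, (legs i).map (ℓ ∘ π) = (legs i).map ℓ := fun i =>
    List.map_congr_left fun h hh => by simp [hlegs i h hh]
  simp only [hA, term, hl]

/-- The vertex of `x` is split off from the product over the vertices. -/
theorem vertexProd_eq [Fintype H] [DecidableEq H] {rot : H → H} (hrot : ∀ h, rot (rot (rot h)) = h)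
    {x : H} (hx : rot x ≠ x) (ℓ : H → B) :
    L.vertexProd rot ℓ = L.form (ℓ x) (ℓ (rot x)) (ℓ (rot (rot x))) *
      ∏ h ∈ (orbit rot x)ᶜ, L.localForm rot ℓ h := by
  rw [vertexProd, ← Finset.prod_mul_prod_compl (orbit rot x), L.prod_orbit hrot hx]

theorem prod_congr_of_rot_mem_iff {rot : H → H} {S : Finset H}
    {ℓ ℓ' : H → B} (hS : ∀ h, rot h ∈ S ↔ h ∈ S) (hℓ : ∀ h ∈ S, ℓ h = ℓ' h) :
    ∏ h ∈ S, L.localForm rot ℓ h = ∏ h ∈ S, L.localForm rot ℓ' h :=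
  Finset.prod_congr rfl fun h hh => L.localForm_congr (hℓ _ hh) (hℓ _ (by rwa [hS]))
    (hℓ _ (by rwa [hS, hS]))

/-- The summands cancel one by one: only the factor of the vertex of `x` changes, and it changes its
sign. -/
theorem weight_as [Fintype H] (Φ : Fin 2 → List B → ℤ) (flip : H → H) {rot : H → H}
    (hrot : ∀ h, rot (rot (rot h)) = h) (legs : Fin 2 → List H)
    (hlegs : ∀ i, ∀ h ∈ legs i, rot h = h) {x : H} (hx : rot x ≠ x) (π : Equiv.Perm H)
    (hπ : π = JacobiDiagram.exchange (rot x) (rot (rot x))) :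
    L.weight Φ flip rot legs + L.weight Φ (fun h => π.symm (flip (π h))) rot legs = 0 := by
  classical
  obtain ⟨hx1, hx2⟩ := rot_ne hrot hx
  have hpi : ∀ h, π h = Equiv.swap (rot x) (rot (rot x)) h := fun h => by
    rw [hπ, JacobiDiagram.exchange]
  have hfix : ∀ h, h ≠ rot x → h ≠ rot (rot x) → π h = h := fun h h1 h2 => by
    rw [hpi, Equiv.swap_apply_of_ne_of_ne h1 h2]
  have hleg : ∀ i, ∀ h ∈ legs i, π h = h := fun i h hh => by
    have hr := hlegs i h hh
    refine hfix h ?_ ?_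
    · rintro rfl; exact hx1 hr
    · rintro rfl; rw [hrot] at hr; exact hx2 hr.symm
  rw [L.weight_reglue Φ flip rot legs π hleg, weight, ← Finset.sum_add_distrib]
  refine Finset.sum_eq_zero fun ℓ _ => ?_
  have key : L.vertexProd rot (ℓ ∘ π) = -L.vertexProd rot ℓ := by
    rw [L.vertexProd_eq hrot hx, L.vertexProd_eq hrot hx,
      L.prod_congr_of_rot_mem_iff (ℓ' := ℓ) (by simp [mem_orbit_rot hrot])]
    · simp only [Function.comp_apply, hfix x hx.symm hx2.symm]
      rw [hpi, hpi, Equiv.swap_apply_left, Equiv.swap_apply_right, L.form_swap, neg_mul]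
    · intro h hh
      simp only [orbit, Finset.mem_compl, Finset.mem_insert, Finset.mem_singleton, not_or] at hh
      simp [hfix h hh.2.1 hh.2.2]
  split_ifs
  · rw [term, key]; ring
  · simp

/-- A given function arises as an update at `x` once for each value that the original may have had
there, hence the factor `card B`. -/
theorem sum_sum_update [Fintype H] [DecidableEq H] (f : (H → B) → ℤ) (x : H) :
    ∑ ℓ, ∑ e, f (Function.update ℓ x e) = Fintype.card B * ∑ ℓ, f ℓ := by
  rw [← (Equiv.funSplitAt x B).symm.sum_comp, ← (Equiv.funSplitAt x B).symm.sum_comp f,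
    Fintype.sum_prod_type, Fintype.sum_prod_type_right]
  have h : ∀ b g e, Function.update ((Equiv.funSplitAt x B).symm (b, g)) x e =
      (Equiv.funSplitAt x B).symm (e, g) := fun b g e => by
    ext h
    by_cases hh : h = x
    · subst hh; simp
    · simp [hh]
  simp [h]

/-- A sum over all functions vanishes if the partial sums over the values at two points do. -/
theorem sum_eq_zero_of_sum_update [Fintype H] [DecidableEq H] (f : (H → B) → ℤ) (x y : H)
    (hf : ∀ ℓ, ∑ e, ∑ e', f (Function.update (Function.update ℓ x e) y e') = 0) :
    ∑ ℓ, f ℓ = 0 := by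
  by_cases hB : (Fintype.card B : ℤ) = 0
  · have : IsEmpty B := Fintype.card_eq_zero_iff.1 (by exact_mod_cast hB)
    have : IsEmpty (H → B) := ⟨fun ℓ => IsEmpty.false (ℓ x)⟩
    simp
  · have h1 := sum_sum_update f y
    have h2 := sum_sum_update (fun ℓ => ∑ e, f (Function.update ℓ y e)) x
    simp only [hf, Finset.sum_const_zero, h1] at h2
    exact (mul_eq_zero.1 ((mul_eq_zero.1 h2.symm).resolve_left hB)).resolve_left hB

/-- With all labels fixed except those of the edge from `x` to `y`, the three diagrams have the same
factors away from its two end vertices. Summing over the label of that edge leaves the Jacobi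
identity for the four remaining labels at these vertices. -/
theorem weight_ihx [Fintype H] (Φ : Fin 2 → List B → ℤ) {flip rot : H → H}
    (hflip : ∀ h, flip (flip h) = h) (hflip' : ∀ h, flip h ≠ h)
    (hrot : ∀ h, rot (rot (rot h)) = h) (legs : Fin 2 → List H)
    (hlegs : ∀ i, ∀ h ∈ legs i, rot h = h) {x y : H} (hfx : flip x = y)
    (hx : rot x ≠ x) (hy : rot y ≠ y) (h₁ : y ≠ rot x) (h₂ : y ≠ rot (rot x))
    (π : Equiv.Perm H) (hπ : π = JacobiDiagram.exchange (rot x) (rot (rot x)) *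
        JacobiDiagram.exchange (rot (rot x)) (rot y)) :
    L.weight Φ flip rot legs + L.weight Φ (fun h => π.symm (flip (π h))) rot legs +
      L.weight Φ (fun h => (π * π).symm (flip ((π * π) h))) rot legs = 0 := by
  classical
  obtain ⟨hx1, hx2⟩ := rot_ne hrot hx
  obtain ⟨hy1, hy2⟩ := rot_ne hrot hy
  have inj : ∀ a b, rot a = rot b ↔ a = b := fun a b =>
    ⟨fun hab => by rw [← hrot a, hab, hrot], fun hab => by rw [hab]⟩
  have hxy : y ≠ x := hfx ▸ hflip' x
  have hff : flip y = x := by rw [← hfx, hflip]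
  have hd : y ∉ orbit rot x := by simp [orbit, h₁, h₂, hxy]
  have hd1 : rot y ∉ orbit rot x := by rwa [mem_orbit_rot hrot]
  have hd2 : rot (rot y) ∉ orbit rot x := by rwa [mem_orbit_rot hrot, mem_orbit_rot hrot]
  simp only [orbit, Finset.mem_insert, Finset.mem_singleton, not_or] at hd hd1 hd2
  obtain ⟨ha1, ha2, ha3⟩ := hd
  obtain ⟨hb1, hb2, hb3⟩ := hd1
  obtain ⟨hc1, hc2, hc3⟩ := hd2
  have hpi : ∀ h, π h = Equiv.swap (rot x) (rot (rot x)) (Equiv.swap (rot (rot x)) (rot y) h) :=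
    fun h => by
      rw [hπ, JacobiDiagram.exchange, JacobiDiagram.exchange, Equiv.Perm.mul_apply]
  have hfix : ∀ h, h ≠ rot x → h ≠ rot (rot x) → h ≠ rot y → π h = h := fun h h1 h2 h3 => by
    rw [hpi, Equiv.swap_apply_of_ne_of_ne h2 h3, Equiv.swap_apply_of_ne_of_ne h1 h2]
  -- `π` is the 3-cycle `rot x ↦ rot (rot x) ↦ rot y ↦ rot x`; it fixes `x`, `y` and the fourth
  -- outer half-edge `rot (rot y)`.
  have pa : π (rot x) = rot (rot x) := by
    rw [hpi, Equiv.swap_apply_of_ne_of_ne hx1.symm (Ne.symm hb2), Equiv.swap_apply_left]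
  have pb : π (rot (rot x)) = rot y := by
    rw [hpi, Equiv.swap_apply_left, Equiv.swap_apply_of_ne_of_ne hb2 hb3]
  have pc : π (rot y) = rot x := by
    rw [hpi, Equiv.swap_apply_right, Equiv.swap_apply_right]
  have px : π x = x := hfix x hx.symm hx2.symm (Ne.symm hb1)
  have py : π y = y := hfix y h₁ h₂ hy.symm
  have pd : π (rot (rot y)) = rot (rot y) := hfix _ hc2 hc3 hy1
  have hleg : ∀ i, ∀ h ∈ legs i, π h = h := fun i h hh => by
    have hr := hlegs i h hh
    refine hfix h ?_ ?_ ?_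
    · rintro rfl; exact hx1 hr
    · rintro rfl; rw [hrot] at hr; exact hx2 hr.symm
    · rintro rfl; exact hy1 hr
  have hleg2 : ∀ i, ∀ h ∈ legs i, (π * π) h = h := fun i h hh => by
    rw [Equiv.Perm.mul_apply, hleg i h hh, hleg i h hh]
  rw [L.weight_reglue Φ flip rot legs π hleg, L.weight_reglue Φ flip rot legs (π * π) hleg2, weight,
    ← Finset.sum_add_distrib, ← Finset.sum_add_distrib]
  set S : Finset H := (orbit rot x ∪ orbit rot y)ᶜ with hS
  have hSrot : ∀ h, rot h ∈ S ↔ h ∈ S := by simp [hS, mem_orbit_rot hrot]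
  have hSmem : ∀ h ∈ S, h ≠ x ∧ h ≠ y ∧ π h = h := fun h hh => by
    simp only [hS, orbit, Finset.mem_compl, Finset.mem_union, Finset.mem_insert,
      Finset.mem_singleton, not_or] at hh
    exact ⟨hh.1.1, hh.2.1, hfix h hh.1.2.1 hh.1.2.2 hh.2.2.1⟩
  have hV : ∀ ℓ : H → B, L.vertexProd rot ℓ =
      L.form (ℓ x) (ℓ (rot x)) (ℓ (rot (rot x))) * L.form (ℓ y) (ℓ (rot y)) (ℓ (rot (rot y))) *
        ∏ h ∈ S, L.localForm rot ℓ h := fun ℓ => by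
    rw [vertexProd, ← Finset.prod_mul_prod_compl (orbit rot x ∪ orbit rot y),
      Finset.prod_union, L.prod_orbit hrot hx, L.prod_orbit hrot hy]
    rw [Finset.disjoint_right]
    simp [orbit, ha1, ha2, ha3, hb1, hb2, hb3, hc1, hc2, hc3]
  have hP1 : ∀ ℓ : H → B, ∏ h ∈ S, L.localForm rot (ℓ ∘ π) h = ∏ h ∈ S, L.localForm rot ℓ h :=
    fun ℓ => L.prod_congr_of_rot_mem_iff hSrot fun h hh => by simp [(hSmem h hh).2.2]
  have hP2 : ∀ ℓ : H → B, ∏ h ∈ S, L.localForm rot (ℓ ∘ (π * π)) h =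
      ∏ h ∈ S, L.localForm rot ℓ h :=
    fun ℓ => L.prod_congr_of_rot_mem_iff hSrot fun h hh => by simp [(hSmem h hh).2.2]
  -- Individual terms do not cancel here; the sum over the labels at `x` and `y` is what vanishes.
  refine sum_eq_zero_of_sum_update _ x y fun ℓ => ?_
  have hP : ∀ e e', ∏ h ∈ S, L.localForm rot (Function.update (Function.update ℓ x e) y e') h =
      ∏ h ∈ S, L.localForm rot ℓ h := fun e e' =>
    L.prod_congr_of_rot_mem_iff hSrot fun h hh => by simp [(hSmem h hh).1, (hSmem h hh).2.1]
  have hleg3 : ∀ e e' i, (legs i).map (Function.update (Function.update ℓ x e) y e') =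
      (legs i).map ℓ := fun e e' i => List.map_congr_left fun h hh => by
    have hr := hlegs i h hh
    have h1 : h ≠ x := by rintro rfl; exact hx hr
    have h2 : h ≠ y := by rintro rfl; exact hy hr
    simp [h1, h2]
  -- Since `x` and `y` are the two halves of one edge, their labels are constrained only by each
  -- other, and the remaining condition does not involve `e` and `e'`.
  have hadm : ∀ e e', L.Admissible flip (Function.update (Function.update ℓ x e) y e') ↔
      (∀ h, h ≠ x → h ≠ y → ℓ (flip h) = L.dual (ℓ h)) ∧ e' = L.dual e := fun e e' => by
    have hne : ∀ h, h ≠ x → h ≠ y → flip h ≠ x ∧ flip h ≠ y := fun h h1 h2 =>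
      ⟨fun hh => h2 (by rw [← hfx, ← hh, hflip]), fun hh => h1 (by rw [← hff, ← hh, hflip])⟩
    constructor
    · intro hh
      refine ⟨fun h h1 h2 => ?_, ?_⟩
      · have := hh h
        simpa [h1, h2, hne h h1 h2] using this
      · have := hh x
        simpa [hfx, hxy.symm] using this
    · rintro ⟨hA, rfl⟩ h
      by_cases h1 : h = x
      · subst h1; simp [hfx, hxy.symm]
      · by_cases h2 : h = y
        · subst h2; simp [hff, hxy.symm, L.dual_dual]
        · simpa [h1, h2, hne h h1 h2] using hA h h1 h2
  simp only [hadm, term, hV, hP1, hP2, hP, hleg3, Function.comp_apply, Equiv.Perm.mul_apply, px, py,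
    pa, pb, pc, pd, Function.update_self, Function.update_of_ne hxy.symm,
    Function.update_of_ne hx, Function.update_of_ne hx2, Function.update_of_ne hb1,
    Function.update_of_ne hc1, Function.update_of_ne hy, Function.update_of_ne hy2,
    Function.update_of_ne (Ne.symm ha2), Function.update_of_ne (Ne.symm ha3)]
  by_cases hA : ∀ h, h ≠ x → h ≠ y → ℓ (flip h) = L.dual (ℓ h)
  · simp only [iff_true_intro hA, true_and, Finset.sum_add_distrib, Finset.sum_ite_eq',
      Finset.mem_univ, if_true]
    have hJ := L.jacobi (ℓ (rot x)) (ℓ (rot (rot x))) (ℓ (rot y)) (ℓ (rot (rot y)))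
    refine Eq.trans ?_ ((congrArg ((∏ h ∈ S, L.localForm rot ℓ h) *
      (∏ i, Φ i ((legs i).map ℓ)) * ·) hJ).trans (mul_zero _))
    simp only [Finset.mul_sum, ← Finset.sum_add_distrib]
    exact Finset.sum_congr rfl fun e _ => by ring
  · simp [hA]

/-- The former univalent vertices `p` and `q` contributed `1` each and now belong to the new
trivalent vertex; the new univalent end `Sum.inr false` contributes `1`. -/
theorem vertexProd_join [Fintype H] {rot : H → H} (hrot : ∀ h, rot (rot (rot h)) = h) {p q : H}
    (hp : rot p = p) (hq : rot q = q) (hpq : p ≠ q) (ℓ : H → B) (μ : Bool → B)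
    (rot' : H ⊕ Bool → H ⊕ Bool) (h₁ : rot' (Sum.inl q) = Sum.inl p)
    (h₂ : rot' (Sum.inl p) = Sum.inr true) (h₃ : rot' (Sum.inr true) = Sum.inl q)
    (h₄ : rot' (Sum.inr false) = Sum.inr false)
    (h₅ : ∀ y, y ≠ p → y ≠ q → rot' (Sum.inl y) = Sum.inl (rot y)) :
    L.vertexProd rot' (Sum.elim ℓ μ) = L.vertexProd rot ℓ * L.form (μ true) (ℓ q) (ℓ p) := by
  classical
  have inj : ∀ a b, rot a = rot b ↔ a = b := fun a b =>
    ⟨fun hab => by rw [← hrot a, hab, hrot], fun hab => by rw [hab]⟩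
  have hrot' : ∀ h, rot' (rot' (rot' h)) = h := by
    rintro (y | _ | _)
    · by_cases h1 : y = p
      · subst h1; rw [h₂, h₃, h₁]
      · by_cases h2 : y = q
        · subst h2; rw [h₁, h₂, h₃]
        · have a1 : rot y ≠ p := by rwa [← hp, Ne, inj]
          have a2 : rot y ≠ q := by rwa [← hq, Ne, inj]
          have b1 : rot (rot y) ≠ p := by rwa [← hp, Ne, inj]
          have b2 : rot (rot y) ≠ q := by rwa [← hq, Ne, inj]
          rw [h₅ y h1 h2, h₅ _ a1 a2, h₅ _ b1 b2, hrot]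
    · simp [h₄]
    · rw [h₃, h₁, h₂]
  have ho : orbit rot' (Sum.inr true) = {Sum.inr true, Sum.inl q, Sum.inl p} := by
    simp [orbit, h₃, h₁]
  rw [L.vertexProd_eq hrot' (x := Sum.inr true) (by simp [h₃]), mul_comm, h₃, h₁, Sum.elim_inr,
    Sum.elim_inl, Sum.elim_inl]
  congr 1
  have hc : (orbit rot' (Sum.inr true))ᶜ =
      insert (Sum.inr false) (({p, q} : Finset H)ᶜ.map Function.Embedding.inl) := by
    rw [ho]
    ext (y | _ | _) <;> simp [and_comm]
  rw [hc, Finset.prod_insert (by simp), Finset.prod_map, vertexProd,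
    ← Finset.prod_mul_prod_compl {p, q}, Finset.prod_pair hpq]
  have h0 : L.localForm rot' (Sum.elim ℓ μ) (Sum.inr false) = 1 := by simp [localForm, h₄]
  rw [h0, localForm, if_pos hp, localForm, if_pos hq, mul_one, one_mul, one_mul]
  refine Finset.prod_congr rfl fun y hy => ?_
  simp only [Finset.mem_compl, Finset.mem_insert, Finset.mem_singleton, not_or] at hy
  have a1 : rot y ≠ p := by rw [← hp, Ne, inj]; exact hy.1
  have a2 : rot y ≠ q := by rw [← hq, Ne, inj]; exact hy.2
  simp [localForm, h₅ _ hy.1 hy.2, h₅ _ a1 a2]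

/-- For a fixed labeling of the old half-edges, the sum over the label of the new edge is the right
hand side of `IsEnveloping` at the letters `ℓ p` and `ℓ q`, multiplied by factors common to all
three diagrams. -/
theorem weight_stu [Fintype H] (Φ : Fin 2 → List B → ℤ) (hΦ : ∀ i, L.IsEnveloping (Φ i))
    {flip rot : H → H} (hrot : ∀ h, rot (rot (rot h)) = h) {legs : Fin 2 → List H}
    {i : Fin 2} {l₁ l₂ : List H} {p q : H} (hp : rot p = p) (hq : rot q = q) (hpq : p ≠ q)
    (h : legs i = l₁ ++ p :: q :: l₂) (rot' : H ⊕ Bool → H ⊕ Bool)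
    (h₁ : rot' (Sum.inl q) = Sum.inl p)
    (h₂ : rot' (Sum.inl p) = Sum.inr true) (h₃ : rot' (Sum.inr true) = Sum.inl q)
    (h₄ : rot' (Sum.inr false) = Sum.inr false)
    (h₅ : ∀ y, y ≠ p → y ≠ q → rot' (Sum.inl y) = Sum.inl (rot y)) :
    L.weight Φ (Sum.map flip not) rot' (fun j => if j = i then
        l₁.map Sum.inl ++ Sum.inr false :: l₂.map Sum.inl else (legs j).map Sum.inl) -
      L.weight Φ flip rot legs +
      L.weight Φ flip rot (fun j => if j = i then l₁ ++ q :: p :: l₂ else legs j) = 0 := by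
  classical
  -- An admissible labeling of the new edge is determined by the label `e` of its end on the strand;
  -- the end at the new vertex then carries `L.dual e`.
  have hsum : ∀ f : (Bool → B) → ℤ, ∑ μ, (if ∀ b, μ (!b) = L.dual (μ b) then f μ else 0) =
      ∑ e, f (fun b => if b then L.dual e else e) := fun f => by
    rw [← Finset.sum_filter]
    symm
    refine Finset.sum_bij (fun e _ b => if b then L.dual e else e) ?_ ?_ ?_ ?_
    · simp [L.dual_dual]
    · intro a _ b _ hab
      simpa using congrFun hab false
    · intro μ hμ
      simp only [Finset.mem_filter, Finset.mem_univ, true_and, Bool.forall_bool] at hμ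
      refine ⟨μ false, Finset.mem_univ _, ?_⟩
      ext b
      cases b
      · simp
      · simpa using hμ.1.symm
    · intros; rfl
  have hadm : ∀ (ℓ : H → B) (μ : Bool → B), L.Admissible (Sum.map flip not) (Sum.elim ℓ μ) ↔
      L.Admissible flip ℓ ∧ ∀ b, μ (!b) = L.dual (μ b) := fun ℓ μ => by
    simp [Admissible, Sum.forall]
  have hprod : ∀ g : Fin 2 → List B, ∏ j, Φ j (g j) =
      Φ i (g i) * ∏ j ∈ Finset.univ.erase i, Φ j (g j) := fun g =>
    (Finset.mul_prod_erase _ _ (Finset.mem_univ i)).symm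
  have hrest : ∀ (g g' : Fin 2 → List B), (∀ j, j ≠ i → g j = g' j) →
      ∏ j ∈ Finset.univ.erase i, Φ j (g j) = ∏ j ∈ Finset.univ.erase i, Φ j (g' j) :=
    fun g g' hg => Finset.prod_congr rfl fun j hj => by rw [hg j (Finset.ne_of_mem_erase hj)]
  rw [weight_eq, weight_eq, weight_eq]
  rw [← (Equiv.sumArrowEquivProdArrow H Bool B).symm.sum_comp, Fintype.sum_prod_type,
    ← Finset.sum_sub_distrib, ← Finset.sum_add_distrib]
  refine Finset.sum_eq_zero fun ℓ _ => ?_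
  have hs : ∀ μ, (Equiv.sumArrowEquivProdArrow H Bool B).symm (ℓ, μ) = Sum.elim ℓ μ :=
    fun μ => rfl
  simp only [hs, hadm]
  by_cases hA : L.Admissible flip ℓ
  · simp only [hA, true_and, if_true, hsum, term,
      L.vertexProd_join hrot hp hq hpq ℓ _ rot' h₁ h₂ h₃ h₄ h₅]
    have hrest1 : ∀ μ : Bool → B, ∏ j ∈ Finset.univ.erase i, Φ j (List.map (Sum.elim ℓ μ)
        (if j = i then
        l₁.map Sum.inl ++ Sum.inr false :: l₂.map Sum.inl else (legs j).map Sum.inl)) =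
        ∏ j ∈ Finset.univ.erase i, Φ j (List.map ℓ (legs j)) := fun μ =>
      hrest _ _ fun j hj => by simp [hj]
    have hrest2 : ∏ j ∈ Finset.univ.erase i, Φ j (List.map ℓ (if j = i then
        l₁ ++ q :: p :: l₂ else legs j)) =
        ∏ j ∈ Finset.univ.erase i, Φ j (List.map ℓ (legs j)) :=
      hrest _ _ fun j hj => by simp [hj]
    have hE := hΦ i (l₁.map ℓ) (l₂.map ℓ) (ℓ p) (ℓ q)
    simp only [hprod, hrest1, hrest2, if_true, h, List.map_append, List.map_cons, List.map_map,
      Sum.elim_inr, Sum.elim_comp_inl]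
    simp only [Bool.false_eq_true, if_false]
    rw [sub_eq_iff_eq_add] at hE
    rw [hE]
    simp only [add_mul, mul_add, Finset.sum_mul, Finset.mul_sum, mul_assoc]
    simp
  · simp [hA]

end LieForm

/-! ### The weight as an invariant of classes in the algebra. -/

namespace JacobiDiagram

variable {B : Type} [Fintype B] (L : LieForm B) (Φ : Fin 2 → List B → ℤ)

/-- The weight of a Jacobi diagram. -/
noncomputable def weight (D : JacobiDiagram) : ℤ :=
  have := D.finite
  letI := Fintype.ofFinite D.H
  L.weight Φ D.flip D.rot D.legs

theorem weight_eq (D : JacobiDiagram) [Fintype D.H] :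
    D.weight L Φ = L.weight Φ D.flip D.rot D.legs := by
  unfold weight
  congr!

theorem Iso.weight_eq {D E : JacobiDiagram} (h : D.Iso E) : D.weight L Φ = E.weight L Φ := by
  obtain ⟨e, h1, h2, h3⟩ := h
  have := D.finite
  have := E.finite
  let := Fintype.ofFinite D.H
  let := Fintype.ofFinite E.H
  rw [JacobiDiagram.weight_eq, JacobiDiagram.weight_eq]
  exact L.weight_congr Φ e h1 h2 h3

/-- The linear extension of the weight to all combinations of diagrams. -/
noncomputable def weightLinear : MonoidAlgebra ℚ JacobiClass →ₗ[ℚ] ℚ :=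
  (Finsupp.linearCombination ℚ fun c : JacobiClass =>
    ((Quotient.lift (weight L Φ) (fun _ _ h => Iso.weight_eq L Φ h) c : ℤ) : ℚ)) ∘ₗ
      (MonoidAlgebra.coeffLinearEquiv ℚ).toLinearMap

theorem weightLinear_basis (D : JacobiDiagram) :
    weightLinear L Φ D.basis = (D.weight L Φ : ℚ) := by
  have h : (MonoidAlgebra.coeffLinearEquiv ℚ) D.basis = Finsupp.single D.toClass 1 := by
    simp [basis]
  rw [weightLinear, LinearMap.comp_apply, LinearEquiv.coe_coe, h,
    Finsupp.linearCombination_single, one_smul]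
  rfl

theorem rot_eq_of_mem (D : JacobiDiagram) (i : Fin 2) (h : D.H) (hh : h ∈ D.legs i) :
    D.rot h = h :=
  (D.mem_legs h).2 ⟨i, hh⟩

theorem weightLinear_of_isRelator (hΦ : ∀ i, L.IsEnveloping (Φ i))
    {r : MonoidAlgebra ℚ JacobiClass} (hr : IsRelator r) : weightLinear L Φ r = 0 := by
  cases hr with
  | as D x hx =>
    have := D.finite
    let := Fintype.ofFinite D.H
    rw [map_add, weightLinear_basis, weightLinear_basis, weight_eq, weight_eq]
    exact_mod_cast L.weight_as Φ D.flip D.rot_rot_rot D.legs D.rot_eq_of_mem hx _ rfl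
  | ihx D x hx hy h₁ h₂ π hπ =>
    have := D.finite
    let := Fintype.ofFinite D.H
    rw [map_add, map_add, weightLinear_basis, weightLinear_basis, weightLinear_basis, weight_eq,
      weight_eq, weight_eq]
    exact_mod_cast L.weight_ihx Φ D.flip_flip D.flip_ne D.rot_rot_rot D.legs D.rot_eq_of_mem rfl hx
      hy h₁ h₂ π hπ
  | stu D i l₁ l₂ p q h =>
    have := D.finite
    let := Fintype.ofFinite D.H
    have hnd := D.legs_nodup i
    rw [h] at hnd
    have hpq : p ≠ q := by
      rintro rfl
      simp [List.nodup_append] at hnd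
    rw [map_add, map_sub, weightLinear_basis, weightLinear_basis, weightLinear_basis, weight_eq,
      weight_eq, weight_eq]
    exact_mod_cast L.weight_stu Φ hΦ D.rot_rot_rot (D.rot_eq_of_mem i p (by simp [h]))
      (D.rot_eq_of_mem i q (by simp [h])) hpq h (D.join i l₁ l₂ p q h).rot (by simp)
      (by simp [hpq]) (by simp) (by simp) (fun y h1 h2 => by simp [h1, h2])

/-- Diagrams with the same class in the algebra have the same weight. -/
theorem weight_eq_of_toAlgebra_eq (hΦ : ∀ i, L.IsEnveloping (Φ i)) {D E : JacobiDiagram}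
    (h : D.toAlgebra = E.toAlgebra) : D.weight L Φ = E.weight L Φ := by
  have h1 : D.basis - E.basis ∈ relations := (RingCon.eq relationsCon).1 h
  have h2 : relations ≤ LinearMap.ker (weightLinear L Φ) :=
    Submodule.span_le.2 fun r hr => weightLinear_of_isRelator L Φ hΦ hr
  have h3 := h2 h1
  rw [LinearMap.mem_ker, map_sub, weightLinear_basis, weightLinear_basis, sub_eq_zero] at h3
  exact_mod_cast h3

theorem toAlgebra_mul (D E : JacobiDiagram) :
    D.toAlgebra * E.toAlgebra = (D.stack E).toAlgebra := by
  unfold toAlgebra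
  rw [← basis_mul]
  rfl

end JacobiDiagram

/-! ### Convolution of functions on words. -/

section Words

variable {B : Type}

/-- The convolution of two functions on words with respect to the unshuffling coproduct. -/
def wordConv : (List B → ℤ) → (List B → ℤ) → List B → ℤ
  | Φ, Ψ, [] => Φ [] * Ψ []
  | Φ, Ψ, b :: w => wordConv (fun u => Φ (b :: u)) Ψ w + wordConv Φ (fun u => Ψ (b :: u)) w

/-- The unit of the convolution. -/
def wordCounit (w : List B) : ℤ := if w = [] then 1 else 0

/-- The powers with respect to the convolution. -/
def wordPow (Φ : List B → ℤ) : ℕ → List B → ℤ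
  | 0 => wordCounit
  | n + 1 => wordConv Φ (wordPow Φ n)

theorem wordConv_sub_left (Φ Φ' Ψ : List B → ℤ) (w : List B) :
    wordConv (fun u => Φ u - Φ' u) Ψ w = wordConv Φ Ψ w - wordConv Φ' Ψ w := by
  induction w generalizing Φ Φ' Ψ with
  | nil => simp only [wordConv]; ring
  | cons b w ih => simp only [wordConv, ih]; ring

theorem wordConv_sub_right (Φ Ψ Ψ' : List B → ℤ) (w : List B) :
    wordConv Φ (fun u => Ψ u - Ψ' u) w = wordConv Φ Ψ w - wordConv Φ Ψ' w := by
  induction w generalizing Φ Ψ Ψ' with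
  | nil => simp only [wordConv]; ring
  | cons b w ih => simp only [wordConv, ih]; ring

theorem wordConv_sum_left {ι : Type} (s : Finset ι) (c : ι → ℤ) (Φ : ι → List B → ℤ)
    (Ψ : List B → ℤ) (w : List B) :
    wordConv (fun u => ∑ e ∈ s, c e * Φ e u) Ψ w = ∑ e ∈ s, c e * wordConv (Φ e) Ψ w := by
  induction w generalizing Φ Ψ with
  | nil => simp only [wordConv, Finset.sum_mul, mul_assoc]
  | cons b w ih =>
    simp only [wordConv, mul_add, Finset.sum_add_distrib, ih _ Ψ, ih Φ]

theorem wordConv_sum_right {ι : Type} (s : Finset ι) (c : ι → ℤ) (Φ : List B → ℤ)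
    (Ψ : ι → List B → ℤ) (w : List B) :
    wordConv Φ (fun u => ∑ e ∈ s, c e * Ψ e u) w = ∑ e ∈ s, c e * wordConv Φ (Ψ e) w := by
  induction w generalizing Φ Ψ with
  | nil => simp only [wordConv, Finset.mul_sum, mul_left_comm]
  | cons b w ih =>
    simp only [wordConv, mul_add, Finset.sum_add_distrib, ih _ Ψ]
    rw [ih Φ (fun e u => Ψ e (b :: u))]

/-- The convolution sums over all ways to distribute the letters of `w` between `Φ` and `Ψ`; only
the one that gives every letter to `Ψ` survives. -/
theorem wordConv_eq_of_lt (Φ Ψ : List B → ℤ) (w : List B)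
    (hΨ : ∀ u : List B, u.length < w.length → Ψ u = 0) : wordConv Φ Ψ w = Φ [] * Ψ w := by
  induction w generalizing Φ Ψ with
  | nil => rfl
  | cons b w ih =>
    rw [wordConv, ih _ _ fun u hu => hΨ u (by simp; omega),
      ih _ _ fun u hu => hΨ (b :: u) (by simpa using hu), hΨ w (by simp)]
    simp

/-- `Φ` must receive at least one letter as `Φ [] = 0`, and at most one by the vanishing of `Ψ` on
shorter words. The factor `w.length` counts the choices of that letter. -/
theorem wordConv_eq_of_linear {Φ : List B → ℤ} {ψ : B → ℤ} (h₀ : Φ [] = 0)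
    (h₁ : ∀ b, Φ [b] = ψ b) (w : List B) (Ψ : List B → ℤ) (c : ℤ)
    (hΨ : ∀ u : List B, u.length + 1 < w.length → Ψ u = 0)
    (hΨ' : ∀ u : List B, u.length + 1 = w.length → Ψ u = c * (u.map ψ).prod) :
    wordConv Φ Ψ w = w.length * c * (w.map ψ).prod := by
  induction w generalizing Ψ c with
  | nil => simp [wordConv, h₀]
  | cons b w ih =>
    rw [wordConv, wordConv_eq_of_lt _ _ _ fun u hu => hΨ u (by simpa using hu), h₁,
      hΨ' w (by simp), ih _ (c * ψ b) (fun u hu => hΨ (b :: u) (by simpa using hu))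
        (fun u hu => by rw [hΨ' (b :: u) (by simpa using hu)]; simp; ring)]
    simp
    ring

theorem wordPow_eq_zero {Φ : List B → ℤ} (h₀ : Φ [] = 0) (n : ℕ) (w : List B)
    (hw : w.length < n) : wordPow Φ n w = 0 := by
  induction n generalizing w with
  | zero => simp at hw
  | succ n ih =>
    rw [wordPow, wordConv_eq_of_lt _ _ _ fun u hu => ih u (by omega), h₀, zero_mul]

/-- With `n` letters for `n` factors that vanish on the empty word, each factor receives exactly one
letter, in `n!` ways. -/
theorem wordPow_eq {Φ : List B → ℤ} {ψ : B → ℤ} (h₀ : Φ [] = 0) (h₁ : ∀ b, Φ [b] = ψ b) (n : ℕ)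
    (w : List B) (hw : w.length = n) : wordPow Φ n w = n.factorial * (w.map ψ).prod := by
  induction n generalizing w with
  | zero =>
    obtain rfl : w = [] := List.length_eq_zero_iff.1 hw
    simp [wordPow, wordCounit]
  | succ n ih =>
    rw [wordPow, wordConv_eq_of_linear h₀ h₁ w _ n.factorial
      (fun u hu => wordPow_eq_zero h₀ n u (by omega)) (fun u hu => ih u (by omega)), hw,
      Nat.factorial_succ]
    push_cast
    ring

end Words

/-! ### Linear forms on the enveloping algebra. -/

namespace LieForm.IsEnveloping

variable {B : Type} [Fintype B] {L : LieForm B} {Φ Ψ : List B → ℤ}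

theorem cons (hΦ : L.IsEnveloping Φ) (b : B) : L.IsEnveloping fun u => Φ (b :: u) :=
  fun l₁ l₂ p q => hΦ (b :: l₁) l₂ p q

theorem wordCounit : L.IsEnveloping wordCounit := fun l₁ l₂ p q => by
  simp [_root_.wordCounit]

theorem sub (hΦ : L.IsEnveloping Φ) (hΨ : L.IsEnveloping Ψ) :
    L.IsEnveloping fun w => Φ w - Ψ w := fun l₁ l₂ p q => by
  have h1 := hΦ l₁ l₂ p q
  have h2 := hΨ l₁ l₂ p q
  simp only [mul_sub, Finset.sum_sub_distrib, ← h1, ← h2]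
  ring

theorem mul_left (c : ℤ) (hΦ : L.IsEnveloping Φ) : L.IsEnveloping fun w => c * Φ w :=
  fun l₁ l₂ p q => by
    rw [← mul_sub, hΦ l₁ l₂ p q, Finset.mul_sum]
    exact Finset.sum_congr rfl fun e _ => by ring

theorem sum {ι : Type} (s : Finset ι) {Φ : ι → List B → ℤ} (hΦ : ∀ i, L.IsEnveloping (Φ i)) :
    L.IsEnveloping fun w => ∑ i ∈ s, Φ i w := fun l₁ l₂ p q => by
  simp only [← Finset.sum_sub_distrib, Finset.mul_sum, hΦ _ l₁ l₂ p q]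
  exact Finset.sum_comm

/-- Letters are primitive for the coproduct. When `p` and `q` go to different factors, their order
does not matter and the terms cancel in the difference; when both go to the same factor, the
relation for that factor applies. -/
theorem wordConv (hΦ : L.IsEnveloping Φ) (hΨ : L.IsEnveloping Ψ) :
    L.IsEnveloping (wordConv Φ Ψ) := fun l₁ l₂ p q => by
  induction l₁ generalizing Φ Ψ with
  | nil =>
    have h1 : ∀ u, Φ (p :: q :: u) - Φ (q :: p :: u) = _ := fun u => hΦ [] u p q
    have h2 : ∀ u, Ψ (p :: q :: u) - Ψ (q :: p :: u) = _ := fun u => hΨ [] u p q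
    have e1 := wordConv_sub_left (fun u => Φ (p :: q :: u)) (fun u => Φ (q :: p :: u)) Ψ l₂
    have e2 := wordConv_sub_right Φ (fun u => Ψ (p :: q :: u)) (fun u => Ψ (q :: p :: u)) l₂
    simp only [h1, List.nil_append, wordConv_sum_left] at e1
    simp only [h2, List.nil_append, wordConv_sum_right] at e2
    simp only [List.nil_append, _root_.wordConv, mul_add, Finset.sum_add_distrib, e1, e2]
    ring
  | cons a l ih =>
    simp only [List.cons_append, _root_.wordConv, mul_add, Finset.sum_add_distrib,
      ← ih (hΦ.cons a) hΨ, ← ih hΦ (hΨ.cons a)]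
    ring

theorem wordPow (hΦ : L.IsEnveloping Φ) (n : ℕ) : L.IsEnveloping (wordPow Φ n) := by
  induction n with
  | zero => exact wordCounit
  | succ n ih => exact wordConv hΦ ih

end LieForm.IsEnveloping

/-! ### The Lie algebra `𝔤𝔩` and its standard representation. -/

section GeneralLinear

variable {ι : Type} [DecidableEq ι]

/-- The Kronecker delta. -/
def kdelta (i j : ι) : ℤ := if i = j then 1 else 0

theorem kdelta_comm (i j : ι) : kdelta i j = kdelta j i := by
  simp [kdelta, eq_comm]

theorem kdelta_eq (i j : ι) : kdelta i j = 0 ∨ kdelta i j = 1 := by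
  unfold kdelta
  split_ifs <;> simp

variable [Fintype ι]

theorem sum_kdelta_mul (i : ι) (f : ι → ℤ) : ∑ j, kdelta i j * f j = f i := by
  simp [kdelta]

/-- The trilinear form `tr (x [z, y])` of `𝔤𝔩` in the basis of the matrix units. -/
def glTrilinear (x y z : ι × ι) : ℤ :=
  kdelta x.2 z.1 * kdelta z.2 y.1 * kdelta y.2 x.1 -
    kdelta x.2 y.1 * kdelta y.2 z.1 * kdelta z.2 x.1

theorem sum_glTrilinear_mul (a b : ι × ι) (f : ι × ι → ℤ) :
    ∑ e, glTrilinear e a b * f e =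
      kdelta b.2 a.1 * f (a.2, b.1) - kdelta a.2 b.1 * f (b.2, a.1) := by
  have h : ∀ i j : ι, ∑ e : ι × ι, kdelta i e.1 * kdelta j e.2 * f e = f (i, j) :=
    fun i j => by
      simp only [Fintype.sum_prod_type, mul_assoc, ← Finset.mul_sum, sum_kdelta_mul]
  rw [← h a.2 b.1, ← h b.2 a.1, Finset.mul_sum, Finset.mul_sum,
    ← Finset.sum_sub_distrib]
  refine Finset.sum_congr rfl fun e _ => ?_
  rw [glTrilinear, kdelta_comm e.2 b.1, kdelta_comm e.2 a.1]
  ring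

/-- By duality of the matrix units the sum is the linear extension of `f` at the commutator `b a - a
b`. For `a = q`, `b = p` this is `p q - q p`, which explains the sign chosen in `glTrilinear`. -/
theorem sum_glTrilinear_swap_mul (a b : ι × ι) (f : ι × ι → ℤ) :
    ∑ e, glTrilinear e.swap a b * f e =
      kdelta b.2 a.1 * f (b.1, a.2) - kdelta a.2 b.1 * f (a.1, b.2) := by
  rw [← (Equiv.prodComm ι ι).sum_comp]
  exact sum_glTrilinear_mul a b fun e => f e.swap

/-- The Lie algebra `𝔤𝔩` with the trace form. -/
def glForm (ι : Type) [DecidableEq ι] [Fintype ι] : LieForm (ι × ι) where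
  dual := Prod.swap
  dual_dual := Prod.swap_swap
  form := glTrilinear
  form_rot a b c := by unfold glTrilinear; ring
  form_swap a b c := by unfold glTrilinear; ring
  form_cube a b c := by
    unfold glTrilinear
    -- Each of the two products of Kronecker deltas is `0` or `1`, so their difference is `-1`, `0`
    -- or `1`.
    have h : ∀ u v : ℤ, u = 0 ∨ u = 1 → v = 0 ∨ v = 1 →
        (u - v) * (u - v) * (u - v) = u - v := by
      rintro u v (rfl | rfl) (rfl | rfl) <;> norm_num
    have hm : ∀ u v : ℤ, u = 0 ∨ u = 1 → v = 0 ∨ v = 1 → u * v = 0 ∨ u * v = 1 := by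
      rintro u v (rfl | rfl) (rfl | rfl) <;> norm_num
    exact h _ _ (hm _ _ (hm _ _ (kdelta_eq _ _) (kdelta_eq _ _)) (kdelta_eq _ _))
      (hm _ _ (hm _ _ (kdelta_eq _ _) (kdelta_eq _ _)) (kdelta_eq _ _))
  jacobi a b c d := by
    rw [Finset.sum_add_distrib, Finset.sum_add_distrib,
      sum_glTrilinear_mul a b fun e => glTrilinear e.swap c d,
      sum_glTrilinear_mul b c fun e => glTrilinear e.swap a d,
      sum_glTrilinear_mul c a fun e => glTrilinear e.swap b d]
    simp only [glTrilinear, Prod.swap]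
    ring

/-- The entry at `(a, b)` of the product of the matrix units in a word. -/
def matrixEntry (a b : ι) : List (ι × ι) → ℤ
  | [] => kdelta a b
  | e :: w => kdelta a e.1 * matrixEntry e.2 b w

/-- A matrix coefficient of the standard representation is a linear form on the enveloping algebra.
-/
theorem isEnveloping_matrixEntry (a b : ι) : (glForm ι).IsEnveloping (matrixEntry a b) := by
  intro l₁ l₂ p q
  induction l₁ generalizing a with
  | nil =>
    refine Eq.trans ?_ (sum_glTrilinear_swap_mul q p fun e => matrixEntry a b (e :: l₂)).symm
    simp only [List.nil_append, matrixEntry]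
    ring
  | cons e l ih =>
    simp only [List.cons_append, matrixEntry, ← mul_sub, ih, Finset.mul_sum]
    exact Finset.sum_congr rfl fun _ _ => by ring

/-- The function on words that sends `w` to the trace of the product of `w` with the diagonal matrix
`c`, and vanishes on the empty word. -/
def diagTrace (c : ι → ℤ) (w : List (ι × ι)) : ℤ :=
  ∑ i, c i * matrixEntry i i w - (∑ i, c i) * wordCounit w

theorem isEnveloping_diagTrace (c : ι → ℤ) : (glForm ι).IsEnveloping (diagTrace c) :=
  (LieForm.IsEnveloping.sum _ fun i => (isEnveloping_matrixEntry i i).mul_left (c i)).sub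
    (LieForm.IsEnveloping.wordCounit.mul_left _)

theorem diagTrace_nil (c : ι → ℤ) : diagTrace c [] = 0 := by
  simp [diagTrace, matrixEntry, kdelta, wordCounit]

theorem diagTrace_singleton (c : ι → ℤ) (b : ι × ι) :
    diagTrace c [b] = kdelta b.1 b.2 * c b.1 := by
  have h : ∀ i, c i * (kdelta i b.1 * kdelta b.2 i) = kdelta b.1 i * (kdelta b.2 i * c i) :=
    fun i => by rw [kdelta_comm i]; ring
  simp only [diagTrace, matrixEntry, h, sum_kdelta_mul]
  simp [wordCounit, kdelta_comm b.2]

/-- Contracting the rung with the diagonal matrix `c` gives `tr (c [uᵀ, v]) = tr ([c, uᵀ] v)`, and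
the matrix unit `uᵀ` is an eigenvector of `ad c` with eigenvalue `c u.2 - c u.1`. -/
theorem sum_diagTrace_mul_form (c : ι → ℤ) (u v : ι × ι) :
    ∑ e, diagTrace c [e] * (glForm ι).form ((glForm ι).dual e) v ((glForm ι).dual u) =
      if u = v then c u.2 - c u.1 else 0 := by
  have h : ∀ e, diagTrace c [e] * (glForm ι).form ((glForm ι).dual e) v ((glForm ι).dual u) =
      glTrilinear e.swap v u.swap * diagTrace c [e] := fun e => mul_comm _ _
  simp only [h]
  rw [sum_glTrilinear_swap_mul v u.swap fun e => diagTrace c [e]]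
  simp only [diagTrace_singleton, Prod.fst_swap, Prod.snd_swap, kdelta, Prod.ext_iff]
  grind

end GeneralLinear

/-! ### The weight of one comb and of two stacked combs. -/

namespace LieForm

variable {B : Type} [Fintype B] (L : LieForm B)

open Classical in
/-- A sum over the admissible labelings of a comb, where `g` depends on the labels of the legs at the
ends of the column. -/
theorem sum_comb [DecidableEq B] (h χ : B → ℤ)
    (hχ : ∀ u v, ∑ e, h e * L.form (L.dual e) v (L.dual u) =
      if u = v then χ u else 0) (m : ℕ) (g : B → B → ℤ) :
    (∑ ℓ : JacobiDiagram.CombHalfEdge m → B,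
      if L.Admissible (JacobiDiagram.comb m).flip ℓ then
        L.vertexProd (JacobiDiagram.combRot m) ℓ * (∏ k, h (ℓ (Sum.inl (k, false)))) *
          g (ℓ (Sum.inr (0, false))) (ℓ (Sum.inr (Fin.last m, true))) else 0) =
      ∑ b, χ b ^ m * g b (L.dual b) := by
  -- Admissible labelings correspond to free labels on one half of each edge: the strand half of a
  -- rung and the upper half of an edge of the path.
  let lab : (Fin m → B) × (Fin (m + 1) → B) → JacobiDiagram.CombHalfEdge m → B := fun x =>
    Sum.elim (fun y => if y.2 then L.dual (x.1 y.1) else x.1 y.1)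
      (fun y => if y.2 then L.dual (x.2 y.1) else x.2 y.1)
  rw [← Finset.sum_filter]
  have hbij : ∀ f : (JacobiDiagram.CombHalfEdge m → B) → ℤ,
      ∑ ℓ with L.Admissible (JacobiDiagram.comb m).flip ℓ, f ℓ = ∑ x, f (lab x) := fun f => by
    symm
    refine Finset.sum_bij (fun x _ => lab x) ?_ ?_ ?_ ?_
    · intro x _
      simp only [Finset.mem_filter, Finset.mem_univ, true_and]
      rintro (⟨k, _ | _⟩ | ⟨k, _ | _⟩) <;> simp [lab, L.dual_dual]
    · intro x _ y _ hxy
      refine Prod.ext (funext fun k => ?_) (funext fun k => ?_)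
      · simpa [lab] using congrFun hxy (Sum.inl (k, false))
      · simpa [lab] using congrFun hxy (Sum.inr (k, false))
    · intro ℓ hℓ
      simp only [Finset.mem_filter, Finset.mem_univ, true_and] at hℓ
      refine ⟨(fun k => ℓ (Sum.inl (k, false)), fun k => ℓ (Sum.inr (k, false))),
        Finset.mem_univ _, funext ?_⟩
      rintro (⟨k, _ | _⟩ | ⟨k, _ | _⟩)
      · simp [lab]
      · simpa [lab] using (hℓ (Sum.inl (k, false))).symm
      · simp [lab]
      · simpa [lab] using (hℓ (Sum.inr (k, false))).symm
    · intros; rfl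
  have hvert : ∀ x, L.vertexProd (JacobiDiagram.combRot m) (lab x) =
      ∏ k, L.form (L.dual (x.1 k)) (x.2 k.succ) (L.dual (x.2 k.castSucc)) := fun x => by
    rw [vertexProd, Fintype.prod_sum_type, Fintype.prod_prod_type, Fintype.prod_prod_type]
    simp only [Fintype.prod_bool, Finset.prod_mul_distrib]
    rw [Fin.prod_univ_succ (fun j => L.localForm _ (lab x) (Sum.inr (j, false))),
      Fin.prod_univ_castSucc (fun j => L.localForm _ (lab x) (Sum.inr (j, true)))]
    simp only [localForm, JacobiDiagram.combRot, lab, Fin.cases_zero, Fin.cases_succ,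
      Fin.lastCases_last, Fin.lastCases_castSucc, if_true, Finset.prod_const_one, mul_one, one_mul,
      Sum.elim_inl, Sum.elim_inr, reduceCtorEq, if_false, Bool.false_eq_true]
    rw [← Finset.prod_mul_distrib, ← Finset.prod_mul_distrib]
    refine Finset.prod_congr rfl fun k _ => ?_
    -- The three half-edges at the `k`-th vertex lie in three different products; their equal values
    -- are collected here and reduced by `form_cube`.
    rw [L.form_rot, L.form_rot, L.form_rot, if_neg (by simp), ← mul_assoc, L.form_cube]
  rw [hbij]
  simp only [hvert, ← Finset.prod_mul_distrib]
  rw [Fintype.sum_prod_type_right]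
  -- For fixed labels `u` of the path, the sum over the rung labels factors over the vertices, and
  -- `hχ` evaluates each factor as an entry of a diagonal matrix.
  have hstep : ∀ u : Fin (m + 1) → B, ∑ e : Fin m → B,
      (∏ k, L.form (L.dual (e k)) (u k.succ) (L.dual (u k.castSucc)) * h (e k)) *
        g (u 0) (L.dual (u (Fin.last m))) =
      (∏ k : Fin m, if u k.castSucc = u k.succ then χ (u k.castSucc) else 0) *
        g (u 0) (L.dual (u (Fin.last m))) := fun u => by
    simp only [← Finset.sum_mul, ← hχ]
    rw [Finset.prod_univ_sum, Fintype.piFinset_univ]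
    simp only [mul_comm (h _)]
  simp only [lab, Sum.elim_inl, Sum.elim_inr, Bool.false_eq_true, if_false, if_true, hstep]
  symm
  -- Only constant `u` contribute, since a change of label along the column gives an off-diagonal
  -- entry, which is zero.
  refine Fintype.sum_of_injective (fun b _ => b) (fun a b hab => congrFun hab 0) _ _ ?_ ?_
  · intro u hu
    have : ∃ k : Fin m, u k.castSucc ≠ u k.succ := by
      by_contra! hc
      refine hu ⟨u 0, funext fun j => ?_⟩
      induction j using Fin.induction with
      | zero => rfl
      | succ k ih => rw [← hc, ← ih]
    obtain ⟨k, hk⟩ := this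
    rw [Finset.prod_eq_zero (Finset.mem_univ k) (if_neg hk), zero_mul]
  · intro b
    simp

end LieForm

namespace LieForm

variable {B : Type} [Fintype B] (L : LieForm B)

theorem vertexProd_sum {H H' : Type} [Fintype H] [Fintype H'] (rot : H → H) (rot' : H' → H')
    (ℓ : H → B) (ℓ' : H' → B) : L.vertexProd (Sum.map rot rot') (Sum.elim ℓ ℓ') =
      L.vertexProd rot ℓ * L.vertexProd rot' ℓ' := by
  rw [vertexProd, Fintype.prod_sum_type]
  unfold vertexProd
  congr 1 <;> refine Finset.prod_congr rfl fun h _ => ?_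
  · by_cases hh : rot h = h <;> simp [localForm, hh]
  · by_cases hh : rot' h = h <;> simp [localForm, hh]

theorem admissible_sum {H H' : Type} (flip : H → H) (flip' : H' → H') (ℓ : H → B)
    (ℓ' : H' → B) : L.Admissible (Sum.map flip flip') (Sum.elim ℓ ℓ') ↔
      L.Admissible flip ℓ ∧ L.Admissible flip' ℓ' := by
  simp [Admissible, Sum.forall]

end LieForm

/-- The weight of two stacked combs, if the function on the words on the left strand is
multiplicative on words whose length is the number of legs there. -/
theorem JacobiDiagram.weight_comb_stack_comb {B : Type} [Fintype B] [DecidableEq B]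
    (L : LieForm B) (Φ : Fin 2 → List B → ℤ) (h χ : B → ℤ)
    (hχ : ∀ u v, ∑ e, h e * L.form (L.dual e) v (L.dual u) = if u = v then χ u else 0)
    (p q : ℕ) (c : ℤ) (hΦ : ∀ w : List B, w.length = p + q → Φ 0 w = c * (w.map h).prod) :
    ((comb p).stack (comb q)).weight L Φ =
      c * ∑ b, ∑ b', χ b ^ p * χ b' ^ q * Φ 1 [b, L.dual b, b', L.dual b'] := by
  classical
  rw [weight_eq, L.weight_eq,
    ← (Equiv.sumArrowEquivProdArrow (CombHalfEdge p) (CombHalfEdge q) B).symm.sum_comp,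
    Fintype.sum_prod_type]
  have hs : ∀ ℓ ℓ', (Equiv.sumArrowEquivProdArrow (CombHalfEdge p) (CombHalfEdge q) B).symm
      (ℓ, ℓ') = Sum.elim ℓ ℓ' := fun _ _ => rfl
  have hterm : ∀ (ℓ : CombHalfEdge p → B) (ℓ' : CombHalfEdge q → B),
      L.term Φ ((comb p).stack (comb q)).rot ((comb p).stack (comb q)).legs (Sum.elim ℓ ℓ') =
        c * (L.vertexProd (combRot p) ℓ * (∏ k, h (ℓ (Sum.inl (k, false)))) *
          (L.vertexProd (combRot q) ℓ' * (∏ k, h (ℓ' (Sum.inl (k, false)))) *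
            Φ 1 [ℓ (Sum.inr (0, false)), ℓ (Sum.inr (Fin.last p, true)),
              ℓ' (Sum.inr (0, false)), ℓ' (Sum.inr (Fin.last q, true))])) := fun ℓ ℓ' => by
    rw [LieForm.term, Fin.prod_univ_two, hΦ _ (by simp)]
    have hv : L.vertexProd ((comb p).stack (comb q)).rot (Sum.elim ℓ ℓ') = _ :=
      L.vertexProd_sum (combRot p) (combRot q) ℓ ℓ'
    rw [hv]
    simp [← List.ofFn_eq_map, List.prod_ofFn, Function.comp_def]
    ring
  have hadm : ∀ (ℓ : CombHalfEdge p → B) (ℓ' : CombHalfEdge q → B),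
      L.Admissible ((comb p).stack (comb q)).flip (Sum.elim ℓ ℓ') ↔
        L.Admissible (comb p).flip ℓ ∧ L.Admissible (comb q).flip ℓ' := fun ℓ ℓ' =>
    L.admissible_sum _ _ ℓ ℓ'
  have hsplit : ∀ (ℓ : CombHalfEdge p → B), (∑ ℓ' : CombHalfEdge q → B,
      if L.Admissible (comb p).flip ℓ ∧ L.Admissible (comb q).flip ℓ' then
        c * (L.vertexProd (combRot p) ℓ * (∏ k, h (ℓ (Sum.inl (k, false)))) *
          (L.vertexProd (combRot q) ℓ' * (∏ k, h (ℓ' (Sum.inl (k, false)))) *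
            Φ 1 [ℓ (Sum.inr (0, false)), ℓ (Sum.inr (Fin.last p, true)),
              ℓ' (Sum.inr (0, false)), ℓ' (Sum.inr (Fin.last q, true))])) else 0) =
      c * if L.Admissible (comb p).flip ℓ then
        L.vertexProd (combRot p) ℓ * (∏ k, h (ℓ (Sum.inl (k, false)))) *
          ∑ b', χ b' ^ q * Φ 1 [ℓ (Sum.inr (0, false)), ℓ (Sum.inr (Fin.last p, true)),
            b', L.dual b'] else 0 := fun ℓ => by
    by_cases hA : L.Admissible (comb p).flip ℓ
    · have := L.sum_comb h χ hχ q fun b b' =>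
        Φ 1 [ℓ (Sum.inr (0, false)), ℓ (Sum.inr (Fin.last p, true)), b, b']
      rw [if_pos hA, ← this, Finset.mul_sum, Finset.mul_sum]
      refine Finset.sum_congr rfl fun ℓ' _ => ?_
      by_cases hA' : L.Admissible (comb q).flip ℓ'
      · rw [if_pos ⟨hA, hA'⟩, if_pos hA']
      · rw [if_neg fun hh => hA' hh.2, if_neg hA', mul_zero, mul_zero]
    · simp [hA]
  simp only [hs, hterm, hadm, hsplit, ← Finset.mul_sum]
  have := L.sum_comb h χ hχ p fun b b' => ∑ b'', χ b'' ^ q * Φ 1 [b, b', b'', L.dual b'']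
  rw [this]
  simp only [Finset.mul_sum, mul_assoc]

/-! ### The commutator in the third tensor power of the standard representation. -/

/-- The coefficient of `e₁ ⊗ e₂ ⊗ e₀` in the image of `e₀ ⊗ e₁ ⊗ e₂` under a word in `𝔤𝔩₃`. -/
def cyclicEntry : List (Fin 3 × Fin 3) → ℤ :=
  wordConv (matrixEntry 1 0) (wordConv (matrixEntry 2 1) (matrixEntry 0 2))

theorem isEnveloping_cyclicEntry : (glForm (Fin 3)).IsEnveloping cyclicEntry :=
  (isEnveloping_matrixEntry _ _).wordConv
    ((isEnveloping_matrixEntry _ _).wordConv (isEnveloping_matrixEntry _ _))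

/-- For `i ≠ j` the sum `i + j` modulo `3` determines the pair `{i, j}`, hence the transposition by
which `E_ij E_ji` acts, up to adding `1`. Two different transpositions multiply to one 3-cycle in
one order and to its inverse in the other; the entry detects one of the two, hence the sign.
Diagonal units act as the identity on the tensors in question. -/
theorem cyclicEntry_sub_cyclicEntry : ∀ i j k l : Fin 3,
    cyclicEntry [(i, j), (j, i), (k, l), (l, k)] - cyclicEntry [(k, l), (l, k), (i, j), (j, i)] =
      if i = j ∨ k = l ∨ i + j = k + l then 0 else if i + j + 1 = k + l then -1 else 1 := by
  decide

theorem proposition4p5 (n : ℕ) (hn : 2 ≤ n) :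
    ¬ Commute (jacobiJ 3) (jacobiJ (2 * n + 1)) := by
  intro hcomm
  -- The differences of these entries are `1`, `2`, `3` up to sign, so that the three squares `1`,
  -- `4`, `9` are distinct.
  let c : Fin 3 → ℤ := ![0, 1, 3]
  -- The power is the total number of legs on the left strand, which is the same for both products.
  let Φ : Fin 2 → List (Fin 3 × Fin 3) → ℤ := ![wordPow (diagTrace c) (2 + 2 * n), cyclicEntry]
  have hΦ : ∀ i, (glForm (Fin 3)).IsEnveloping (Φ i) := by
    rw [Fin.forall_fin_two]
    exact ⟨(isEnveloping_diagTrace c).wordPow _, isEnveloping_cyclicEntry⟩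
  have hword : ∀ w : List (Fin 3 × Fin 3), w.length = 2 + 2 * n →
      Φ 0 w = (2 + 2 * n).factorial * (w.map fun b => diagTrace c [b]).prod := fun w hw =>
    wordPow_eq (diagTrace_nil c) (fun _ => rfl) _ w hw
  have h1 : ((JacobiDiagram.comb 2).stack (JacobiDiagram.comb (2 * n))).toAlgebra =
      ((JacobiDiagram.comb (2 * n)).stack (JacobiDiagram.comb 2)).toAlgebra := by
    rw [← JacobiDiagram.toAlgebra_mul, ← JacobiDiagram.toAlgebra_mul]
    exact hcomm
  have h2 := JacobiDiagram.weight_eq_of_toAlgebra_eq (glForm (Fin 3)) Φ hΦ h1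
  rw [JacobiDiagram.weight_comb_stack_comb (glForm (Fin 3)) Φ _ _ (sum_diagTrace_mul_form c) _ _ _
      hword,
    JacobiDiagram.weight_comb_stack_comb (glForm (Fin 3)) Φ _ _ (sum_diagTrace_mul_form c) _ _ _
      (fun w hw => hword w (by omega))] at h2
  have h3 := mul_left_cancel₀ (Nat.cast_ne_zero.2 (2 + 2 * n).factorial_ne_zero) h2
  -- Renaming the summation indices in the second product gives both products the same coefficients,
  -- so that the commutator on the right strand appears.
  have h4 : ∑ b : Fin 3 × Fin 3, ∑ b' : Fin 3 × Fin 3,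
      (c b.2 - c b.1) ^ 2 * (c b'.2 - c b'.1) ^ (2 * n) *
        (Φ 1 [b, b.swap, b', b'.swap] - Φ 1 [b', b'.swap, b, b.swap]) = 0 := by
    simp only [mul_sub, Finset.sum_sub_distrib]
    rw [sub_eq_zero]
    refine h3.trans (Finset.sum_comm.trans ?_)
    refine Finset.sum_congr rfl fun b _ => Finset.sum_congr rfl fun b' _ => ?_
    rw [mul_comm ((c b'.2 - c b'.1) ^ (2 * n))]
    rfl
  have h5 : ∀ i j k l : Fin 3,
      Φ 1 [(i, j), (j, i), (k, l), (l, k)] - Φ 1 [(k, l), (l, k), (i, j), (j, i)] = _ :=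
    cyclicEntry_sub_cyclicEntry
  -- Both exponents are even, so everything depends only on the squares of the differences of the
  -- entries of `c`.
  simp only [Fintype.sum_prod_type, Prod.swap, h5, pow_mul] at h4
  simp [Fin.sum_univ_three, c] at h4
  -- Up to a constant factor, `h4` says `3 · 9^n - 8 · 4^n + 5 = 0`. With `n = m + 2` the left hand
  -- side is `243 · 9^m - 128 · 4^m + 5`, which is positive because `9^m ≥ 4^m > 0`.
  obtain ⟨m, rfl⟩ := Nat.exists_eq_add_of_le' hn
  have h6 : (4 : ℤ) ^ m ≤ 9 ^ m := pow_le_pow_left₀ (by norm_num) (by norm_num) m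
  have h7 : (0 : ℤ) < 4 ^ m := by positivity
  simp only [pow_add] at h4
  linarith
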